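/- **The gasket.** For an integer $n\ge 0$ let $SG(n)$ be the $n$-th stage graph of the two-dimensional Sierpinski gasket: $SG(0)$ is a triangle, and $SG(n+1)$ consists of three copies of $SG(n)$ placed so that any two of them share one outmost vertex. Let $o$, $a_n$, $b_n$ be the leftmost, rightmost and topmost vertices of $SG(n)$, where $SG(n)$ is always the lower-left part of $SG(n+1)$, so that $o$ is common to all stages. For $k\ge 0$ let $c_k$ be the midpoint of the side $a_{k+1}b_{k+1}$ of $SG(k+1)$, so that $a_k,b_k,c_k$ are the corners of the largest empty triangle of $SG(k+1)$. **The probabilities.** For a vertex $x$ of $SG(n)$ and $j\in\{1,2,3,4\}$: * $F_j(n,x)$ is the proportion, among all spanning trees of $SG(n)$, of those in which $x$ has degree $j$; * $G_j(n,x)$ is the proportion with $x$ of degree $j$ among the spanning forests of $SG(n)$ with exactly two components, one containing $b_n$ and the other containing both $o$ and $a_n$; * $H_j(n,x)$ is the proportion with $x$ of degree $j$ among the spanning forests of $SG(n)$ with exactly three components, with $o,a_n,b_n$ in three different components. **The matrices.** For a vertex $x$ of $SG(m)$, $m\ge1$, let $\tilde x$ be its image under the reflection of $SG(m)$ that fixes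 $o$ and exchanges $a_m$ and $b_m$, and $\hat x$ its image under the reflection that fixes $a_m$ and exchanges $o$ and $b_m$. Let $B_j(m,m-1)$ be the $3\times5$ matrix whose rows, for $x=a_{m-1},\,b_{m-1},\,c_{m-1}$ in this order, are $$\bigl(F_j(m,x),\;G_j(m,x),\;G_j(m,\tilde x),\;G_j(m,\hat x),\;H_j(m,x)\bigr).$$ Let $e_1=(1,0,0,0,0)^T$ and $$L=\begin{pmatrix}\frac23&\frac35&\frac35&\frac35&\frac6{25}\\ \frac16&\frac3{10}&\frac1{10}&0&\frac7{50}\\ \frac16&\frac1{10}&\frac3{10}&\frac1{10}&\frac7{50}\\ 0&0&0&\frac3{10}&\frac6{25}\\ 0&0&0&0&\frac6{25}\end{pmatrix},\quad R=\begin{pmatrix}\frac23&\frac35&\frac1{10}&\frac35&\frac6{25}\\ \frac16&\frac3{10}&\frac1{10}&\frac1{10}&\frac7{50}\\ 0&0&\frac25&0&\frac6{25}\\ \frac16&\frac1{10}&\frac1{10}&\frac3{10}&\frac7{50}\\ 0&0&\frac3{10}&0&\frac6{25}\end{pmatrix},\quad E=\begin{pmatrix}3&0&0&0&0\\0&2&1&0&0\\0&1&1&1&0\\0&0&1&2&0\\0&0&0&0&3\end{pmatrix}.$$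 **Proposition.** Let $n\ge3$ and $j\in\{1,2,3,4\}$. Then the sum $\Phi_j(n)=\sum_{x\in V(SG(n))}F_j(n,x)$ satisfies $$\begin{aligned}\Phi_j(n)&=(1,1,1)\Bigl\{\sum_{m=1}^{n}B_j(m,m-1)R^{n-m}+2\sum_{m=1}^{n-1}B_j(m,m-1)RL^{n-m-1}\\&\qquad+2\sum_{m=1}^{n-2}B_j(m,m-1)\sum_{s=1}^{n-m-1}R(ER)^sL^{n-1-m-s}\Bigr\}e_1+3F_j(n,o)\\ &=(1,1,1)\Bigl\{\sum_{m=1}^{n}B_j(m,m-1)R^{n-m}+2B_j(n-1,n-2)R\\&\qquad+2\sum_{m=1}^{n-2}B_j(m,m-1)\Bigl[\sum_{s=0}^{n-m-1}R(ER)^sL^{n-m-1-s}\Bigr]\Bigr\}e_1+3F_j(n,o).\end{aligned}$$ -/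

import Mathlib

namespace SierpinskiGasket

/-! The Sierpinski gasket is drawn in the triangular lattice: `(p, q)` stands for the point
`p • (1, 0) + q • (1/2, √3/2)` of the plane. Stage `n` fills the triangle with corners
`o = (0, 0)`, `a_n = (2 ^ n, 0)` (rightmost) and `b_n = (0, 2 ^ n)` (topmost). -/

/-- The vertex set of `SG(n)`: a triangle for `n = 0`; stage `n + 1` is made of three copies of
stage `n`, the second and third translated by `a_n` and by `b_n`. -/
def verts : ℕ → Finset (ℕ × ℕ)
  | 0 => {(0, 0), (1, 0), (0, 1)}
  | n + 1 => verts n ∪ (verts n).image (· + (2 ^ n, 0)) ∪ (verts n).image (· + (0, 2 ^ n))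

/-- The edges of `SG(n)`, as a graph on the whole lattice. -/
def latticeGraph : ℕ → SimpleGraph (ℕ × ℕ)
  | 0 => SimpleGraph.fromEdgeSet {s((0, 0), (1, 0)), s((0, 0), (0, 1)), s((1, 0), (0, 1))}
  | n + 1 => latticeGraph n ⊔ (latticeGraph n).map (· + (2 ^ n, 0)) ⊔
      (latticeGraph n).map (· + (0, 2 ^ n))

/-- The type of vertices of `SG(n)`. -/
abbrev Vert (n : ℕ) : Type := {v : ℕ × ℕ // v ∈ verts n}

/-- The Sierpinski gasket graph `SG(n)`. -/
def SG (n : ℕ) : SimpleGraph (Vert n) := (latticeGraph n).comap Subtype.val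

theorem mem_verts_succ {n : ℕ} {v : ℕ × ℕ} : v ∈ verts (n + 1) ↔
    v ∈ verts n ∨ (∃ w ∈ verts n, w + (2 ^ n, 0) = v) ∨ (∃ w ∈ verts n, w + (0, 2 ^ n) = v) := by
  simp only [verts, Finset.mem_union, Finset.mem_image, or_assoc]

theorem o_mem (n : ℕ) : ((0, 0) : ℕ × ℕ) ∈ verts n := by
  induction n with
  | zero => decide
  | succ n ih => exact mem_verts_succ.2 (Or.inl ih)

theorem a_mem (n : ℕ) : ((2 ^ n, 0) : ℕ × ℕ) ∈ verts n := by
  induction n with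
  | zero => decide
  | succ n ih =>
    refine mem_verts_succ.2 (Or.inr (Or.inl ⟨_, ih, ?_⟩))
    ext <;> simp [pow_succ, mul_two]

theorem b_mem (n : ℕ) : ((0, 2 ^ n) : ℕ × ℕ) ∈ verts n := by
  induction n with
  | zero => decide
  | succ n ih =>
    refine mem_verts_succ.2 (Or.inr (Or.inr ⟨_, ih, ?_⟩))
    ext <;> simp [pow_succ, mul_two]

theorem c_mem (n : ℕ) : ((2 ^ n, 2 ^ n) : ℕ × ℕ) ∈ verts (n + 1) := by
  refine mem_verts_succ.2 (Or.inr (Or.inl ⟨_, b_mem n, ?_⟩))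
  ext <;> simp

theorem add_le_of_mem {n : ℕ} {v : ℕ × ℕ} (hv : v ∈ verts n) : v.1 + v.2 ≤ 2 ^ n := by
  induction n generalizing v with
  | zero =>
    simp only [verts, Finset.mem_insert, Finset.mem_singleton] at hv
    rcases hv with rfl | rfl | rfl <;> simp
  | succ n ih =>
    rw [pow_succ]
    rcases mem_verts_succ.1 hv with h | ⟨w, h, rfl⟩ | ⟨w, h, rfl⟩ <;>
      have := ih h <;> simp at * <;> omega

theorem tilde_mem {n : ℕ} {v : ℕ × ℕ} (hv : v ∈ verts n) : (v.2, v.1) ∈ verts n := by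
  induction n generalizing v with
  | zero =>
    simp only [verts, Finset.mem_insert, Finset.mem_singleton] at hv
    rcases hv with rfl | rfl | rfl <;> decide
  | succ n ih =>
    rcases mem_verts_succ.1 hv with h | ⟨w, h, rfl⟩ | ⟨w, h, rfl⟩
    · exact mem_verts_succ.2 (Or.inl (ih h))
    · exact mem_verts_succ.2 (Or.inr (Or.inr ⟨_, ih h, by ext <;> simp⟩))
    · exact mem_verts_succ.2 (Or.inr (Or.inl ⟨_, ih h, by ext <;> simp⟩))

theorem hat_mem {n : ℕ} {v : ℕ × ℕ} (hv : v ∈ verts n) :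
    (v.1, 2 ^ n - v.1 - v.2) ∈ verts n := by
  induction n generalizing v with
  | zero =>
    simp only [verts, Finset.mem_insert, Finset.mem_singleton] at hv
    rcases hv with rfl | rfl | rfl <;> decide
  | succ n ih =>
    rcases mem_verts_succ.1 hv with h | ⟨w, h, rfl⟩ | ⟨w, h, rfl⟩
    · refine mem_verts_succ.2 (Or.inr (Or.inr ⟨_, ih h, ?_⟩))
      have := add_le_of_mem h
      ext <;> simp [pow_succ] <;> omega
    · refine mem_verts_succ.2 (Or.inr (Or.inl ⟨_, ih h, ?_⟩))
      have := add_le_of_mem h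
      ext <;> simp [pow_succ] <;> omega
    · refine mem_verts_succ.2 (Or.inl ?_)
      have := add_le_of_mem h
      convert ih h using 2
      · simp
      · simp only [Prod.fst_add, Prod.snd_add, pow_succ]
        omega

/-- The leftmost vertex `o` of `SG(n)`. -/
def o (n : ℕ) : Vert n := ⟨(0, 0), o_mem n⟩

/-- The rightmost vertex `a_n` of `SG(n)`. -/
def rightmost (n : ℕ) : Vert n := ⟨(2 ^ n, 0), a_mem n⟩

/-- The topmost vertex `b_n` of `SG(n)`. -/
def topmost (n : ℕ) : Vert n := ⟨(0, 2 ^ n), b_mem n⟩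

/-- The vertices `a_k`, `b_k`, `c_k` of `SG(k + 1)`: the corners of its largest lacunary
triangle. -/
def lacunary (k : ℕ) : Fin 3 → Vert (k + 1) :=
  ![⟨(2 ^ k, 0), mem_verts_succ.2 (Or.inl (a_mem k))⟩,
    ⟨(0, 2 ^ k), mem_verts_succ.2 (Or.inl (b_mem k))⟩,
    ⟨(2 ^ k, 2 ^ k), c_mem k⟩]

/-- Reflection of `SG(n)` in its axis through `o`; it exchanges `a_n` and `b_n`. -/
def tilde {n : ℕ} (x : Vert n) : Vert n := ⟨(x.1.2, x.1.1), tilde_mem x.2⟩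

/-- Reflection of `SG(n)` in its axis through `a_n`; it exchanges `o` and `b_n`. The natural
number subtractions do not truncate, by `add_le_of_mem`. -/
def hat {n : ℕ} (x : Vert n) : Vert n := ⟨(x.1.1, 2 ^ n - x.1.1 - x.1.2), hat_mem x.2⟩

/-- The spanning trees of `SG(n)`. -/
def treeSet (n : ℕ) : Set (SimpleGraph (Vert n)) :=
  {T | T ≤ SG n ∧ T.IsTree}

/-- The spanning subgraphs of `SG(n)` that consist of two trees, one containing `b_n` and the
other containing `o` and `a_n`. -/
def twoTreeSet (n : ℕ) : Set (SimpleGraph (Vert n)) :=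
  {T | T ≤ SG n ∧ T.IsAcyclic ∧ Nat.card T.ConnectedComponent = 2 ∧
    T.Reachable (o n) (rightmost n) ∧ ¬ T.Reachable (o n) (topmost n)}

/-- The spanning subgraphs of `SG(n)` that consist of three trees, with `o`, `a_n` and `b_n` in
three different ones. -/
def threeTreeSet (n : ℕ) : Set (SimpleGraph (Vert n)) :=
  {T | T ≤ SG n ∧ T.IsAcyclic ∧ Nat.card T.ConnectedComponent = 3 ∧
    ¬ T.Reachable (o n) (rightmost n) ∧ ¬ T.Reachable (o n) (topmost n) ∧
    ¬ T.Reachable (rightmost n) (topmost n)}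

/-- The proportion of the graphs in `S` in which exactly `j` edges meet at the vertex `x`. -/
noncomputable def degProb {V : Type} (S : Set (SimpleGraph V)) (j : ℕ) (x : V) : ℚ :=
  ({T ∈ S | (T.neighborSet x).ncard = j}.ncard : ℚ) / (S.ncard : ℚ)

/-- `F_j(n, x)`. -/
noncomputable def F (j n : ℕ) (x : Vert n) : ℚ := degProb (treeSet n) j x

/-- `G_j(n, x)`. -/
noncomputable def G (j n : ℕ) (x : Vert n) : ℚ := degProb (twoTreeSet n) j x

/-- `H_j(n, x)`. -/
noncomputable def H (j n : ℕ) (x : Vert n) : ℚ := degProb (threeTreeSet n) j x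

/-- `Φ_j(n)`, the sum of `F_j(n, x)` over all vertices `x` of `SG(n)`. -/
noncomputable def Phi (j n : ℕ) : ℚ := ∑ x : Vert n, F j n x

/-- The `3 × 5` matrix `B_j(k + 1, k)`; its rows belong to `a_k`, `b_k`, `c_k`. -/
noncomputable def B (j k : ℕ) : Matrix (Fin 3) (Fin 5) ℚ :=
  Matrix.of fun i =>
    let x := lacunary k i
    ![F j (k + 1) x, G j (k + 1) x, G j (k + 1) (tilde x), G j (k + 1) (hat x), H j (k + 1) x]

/-- The matrix `L`. -/
def matL : Matrix (Fin 5) (Fin 5) ℚ :=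
  !![2/3, 3/5,  3/5,  3/5,  6/25;
     1/6, 3/10, 1/10, 0,    7/50;
     1/6, 1/10, 3/10, 1/10, 7/50;
     0,   0,    0,    3/10, 6/25;
     0,   0,    0,    0,    6/25]

/-- The matrix `R`. -/
def matR : Matrix (Fin 5) (Fin 5) ℚ :=
  !![2/3, 3/5,  1/10, 3/5,  6/25;
     1/6, 3/10, 1/10, 1/10, 7/50;
     0,   0,    2/5,  0,    6/25;
     1/6, 1/10, 1/10, 3/10, 7/50;
     0,   0,    3/10, 0,    6/25]

/-- The matrix `E`. -/
def matE : Matrix (Fin 5) (Fin 5) ℚ :=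
  !![3, 0, 0, 0, 0;
     0, 2, 1, 0, 0;
     0, 1, 1, 1, 0;
     0, 0, 1, 2, 0;
     0, 0, 0, 0, 3]

/-- The column vector `e₁ = (1, 0, 0, 0, 0)ᵀ`. -/
def e1 : Fin 5 → ℚ := ![1, 0, 0, 0, 0]

/-- The number `(1, 1, 1) M e₁`. -/
def sandwich (M : Matrix (Fin 3) (Fin 5) ℚ) : ℚ :=
  dotProduct ![1, 1, 1] (M.mulVec e1)

end SierpinskiGasket

open SierpinskiGasket

/-! A spanning forest of `SG(n + 1)` each of whose trees contains a corner is the union of three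
such forests of `SG(n)`, one in each copy. Call the partition of the corners induced by a forest its
pattern. Which forests can be glued, and to which pattern, is decided by their patterns alone, and
by induction on `n` the number of forests with the pattern `r` has the form
`A * weight r * ρ ^ blocks r`. The powers of `ρ` cancel, so the probabilities that a vertex `x` has
degree `j` in a random forest of each of the five patterns form a row vector which is multiplied by
a constant matrix `transfer i` whenever `x`, not being a corner, is moved to the copy `i` of `SG(n)`
in `SG(n + 1)`. The sum `S n` of these rows over all vertices except the corners therefore satisfies
`S (n + 1) = S n * ∑ i, transfer i + (1, 1, 1) * B j n`, which gives
`S n = (1, 1, 1) * ∑ m, B j (m - 1) * (∑ i, transfer i) ^ (n - m)`.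

The copy at `a_n` has the transfer matrix `R`, and the other two have conjugates of `R` by
transpositions of the three two-block patterns. On a row `v` invariant under these transpositions,
as `(1, 1, 1) * B j n` is, `∑ i, transfer i` acts as `R * E`. Moreover `L` agrees with `transfer 0`
outside a column that is multiplied by `0` in every `L * (L ^ k * e₁)`, so that each of the two
conjugates satisfies `v * transfer i * R ^ k * e₁ = v * R * L ^ k * e₁`. Expanding
`(∑ i, transfer i) ^ k * e₁` factor by factor from the left leaves the products of the theorem. -/

namespace SierpinskiGasket

open Function SimpleGraph Matrix

/-! ### Forests with terminals -/

section Forests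

variable {ι V W : Type*}

theorem card_edgeSet_eq_sum_connectedComponent [Finite V] (T : SimpleGraph V)
    [Fintype T.ConnectedComponent] :
    Nat.card T.edgeSet = ∑ c : T.ConnectedComponent, Nat.card c.toSimpleGraph.edgeSet := by
  have inclusion_mem (c : T.ConnectedComponent) (e : c.toSimpleGraph.edgeSet) :
      Sym2.map Subtype.val e.1 ∈ T.edgeSet := by
    obtain ⟨⟨u, v⟩, he⟩ := e
    exact he
  rw [← Nat.card_sigma]
  refine (Nat.card_eq_of_bijective
    (fun e : Σ c : T.ConnectedComponent, c.toSimpleGraph.edgeSet =>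
      (⟨_, inclusion_mem e.1 e.2⟩ : T.edgeSet)) ⟨?_, ?_⟩).symm
  · rintro ⟨c, ⟨⟨u, v⟩, he⟩⟩ ⟨c', ⟨e', he'⟩⟩ heq
    have heq : Sym2.map Subtype.val s(u, v) = Sym2.map Subtype.val e' := congrArg Subtype.val heq
    obtain ⟨u', hu', hmem⟩ : ∃ u' ∈ e', u'.1 = u.1 :=
      Sym2.mem_map.1 (heq ▸ Sym2.mem_map.2 ⟨u, Sym2.mem_mk_left _ _, rfl⟩)
    obtain rfl : c = c' := u.2.symm.trans (hmem ▸ u'.2)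
    obtain rfl := Sym2.map.injective Subtype.val_injective heq
    rfl
  · rintro ⟨⟨u, v⟩, he⟩
    have hadj : T.Adj u v := he
    exact ⟨⟨T.connectedComponentMk u, s(⟨u, rfl⟩,
      ⟨v, ConnectedComponent.sound hadj.symm.reachable⟩), he⟩, rfl⟩

theorem card_edgeSet_add_card_connectedComponent [Finite V] {T : SimpleGraph V}
    (hT : T.IsAcyclic) :
    Nat.card T.edgeSet + Nat.card T.ConnectedComponent = Nat.card V := by
  have := Fintype.ofFinite T.ConnectedComponent
  have card_component (c : T.ConnectedComponent) :
      Nat.card c.toSimpleGraph.edgeSet + 1 = Nat.card {v // T.connectedComponentMk v = c} :=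
    (isTree_iff_connected_and_card.1 (hT.isTree_connectedComponent c)).2
  calc Nat.card T.edgeSet + Nat.card T.ConnectedComponent
      = ∑ c : T.ConnectedComponent, (Nat.card c.toSimpleGraph.edgeSet + 1) := by
        rw [card_edgeSet_eq_sum_connectedComponent, Finset.sum_add_distrib, Finset.sum_const,
          Finset.card_univ, smul_eq_mul, mul_one,
          Nat.card_eq_fintype_card (α := T.ConnectedComponent)]
    _ = ∑ c : T.ConnectedComponent, Nat.card {v // T.connectedComponentMk v = c} :=
        Finset.sum_congr rfl fun c _ => card_component c
    _ = Nat.card V := by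
        rw [← Nat.card_sigma, Nat.card_congr (Equiv.sigmaFiberEquiv T.connectedComponentMk)]

theorem isAcyclic_iff_card [Finite V] {T : SimpleGraph V} :
    T.IsAcyclic ↔ Nat.card T.edgeSet + Nat.card T.ConnectedComponent = Nat.card V := by
  refine ⟨card_edgeSet_add_card_connectedComponent, fun hcard => ?_⟩
  obtain ⟨S, hle, hS, hreach⟩ := T.exists_isAcyclic_reachable_eq_le
  have hcomponents : S.ConnectedComponent = T.ConnectedComponent := congrArg Quot hreach
  have hedges : T.edgeSet.ncard = S.edgeSet.ncard := by
    have := card_edgeSet_add_card_connectedComponent hS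
    rw [hcomponents, ← hcard] at this
    exact (Nat.add_right_cancel this).symm
  rwa [← edgeSet_injective (Set.eq_of_subset_of_ncard_le (edgeSet_mono hle) hedges.le)]

theorem card_quotient_comap_eq_iff [Finite V] (s : Setoid V) (t : ι → V) :
    Nat.card (Quotient (s.comap t)) = Nat.card (Quotient s) ↔ ∀ v, ∃ k, s v (t k) := by
  have hinj : Injective (Quotient.map' (s₁ := s.comap t) (s₂ := s) t fun _ _ h => h) := by
    rintro ⟨i⟩ ⟨j⟩ h
    exact Quotient.sound (s := s.comap t) (Quotient.exact (s := s) h)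
  constructor
  · intro hcard v
    have : Finite (Quotient (s.comap t)) := Finite.of_injective _ hinj
    obtain ⟨⟨k⟩, hk⟩ :=
      ((Nat.bijective_iff_injective_and_card _).2 ⟨hinj, hcard⟩).2 (Quotient.mk s v)
    exact ⟨k, s.symm (Quotient.exact (s := s) hk)⟩
  · refine fun hspan => Nat.card_eq_of_bijective _ ⟨hinj, ?_⟩
    rintro ⟨v⟩
    obtain ⟨k, hk⟩ := hspan v
    exact ⟨Quotient.mk (s.comap t) k, Quotient.sound (s := s) (s.symm hk)⟩

/-- The partition of the terminals `t k` into those joined to each other by paths of `T`. -/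
def pattern (t : ι → V) (T : SimpleGraph V) : Setoid ι :=
  T.reachableSetoid.comap t

theorem pattern_rel {t : ι → V} {T : SimpleGraph V} {i j : ι} :
    pattern t T i j ↔ T.Reachable (t i) (t j) :=
  Iff.rfl

/-- The spanning forests of `Γ` each of whose trees contains a terminal, and which join the
terminals according to the partition `r`. -/
def forests (Γ : SimpleGraph V) (t : ι → V) (r : Setoid ι) : Set (SimpleGraph V) :=
  {T | T ≤ Γ ∧ T.IsAcyclic ∧ (∀ v, ∃ k, T.Reachable v (t k)) ∧ pattern t T = r}

theorem card_quotient_pattern_eq_iff [Finite V] {t : ι → V} {T : SimpleGraph V} :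
    Nat.card (Quotient (pattern t T)) = Nat.card T.ConnectedComponent ↔
      ∀ v, ∃ k, T.Reachable v (t k) :=
  card_quotient_comap_eq_iff T.reachableSetoid t

theorem mem_forests_iff_card_connectedComponent [Finite V] {Γ T : SimpleGraph V} {t : ι → V}
    {r : Setoid ι} :
    T ∈ forests Γ t r ↔ T ≤ Γ ∧ T.IsAcyclic ∧
      Nat.card T.ConnectedComponent = Nat.card (Quotient r) ∧ pattern t T = r := by
  refine and_congr_right fun _ => and_congr_right fun _ => and_congr_left ?_
  rintro rfl
  rw [← card_quotient_pattern_eq_iff, eq_comm]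

theorem mem_forests_iff_card_edgeSet [Finite V] {Γ T : SimpleGraph V} {t : ι → V}
    {r : Setoid ι} :
    T ∈ forests Γ t r ↔ T ≤ Γ ∧ Nat.card T.edgeSet + Nat.card (Quotient r) = Nat.card V ∧
      (∀ v, ∃ k, T.Reachable v (t k)) ∧ pattern t T = r := by
  refine and_congr_right fun _ => and_congr_left ?_
  rintro ⟨hspan, rfl⟩
  rw [card_quotient_pattern_eq_iff.2 hspan, isAcyclic_iff_card]

theorem comap_mem_forests_iff (e : V ≃ W) (π : ι ≃ ι) {Γ T : SimpleGraph W} {t : ι → V}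
    {t' : ι → W} (ht : ∀ k, e (t k) = t' (π k)) {r : Setoid ι} :
    T.comap e ∈ forests (Γ.comap e) t (r.comap π) ↔ T ∈ forests Γ t' r := by
  have reachable_iff (u v : V) : (T.comap e).Reachable u v ↔ T.Reachable (e u) (e v) :=
    (Iso.comap e T).reachable_iff.symm
  have hpattern : pattern t (T.comap e) = (pattern t' T).comap π :=
    Setoid.ext fun i j => by
      rw [pattern_rel, Setoid.comap_rel, pattern_rel, reachable_iff, ht, ht]
  refine and_congr ?_ (and_congr (Iso.comap e T).isAcyclic_iff (and_congr ?_ ?_))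
  · simp only [le_iff_adj, comap_adj, e.surjective.forall]
  · exact e.forall_congr fun v => π.exists_congr fun k => by rw [reachable_iff, ht]
  · rw [hpattern, (Setoid.comap_injective π π.surjective).eq_iff]

theorem preimage_comap_forests (e : V ≃ W) (π : ι ≃ ι) {Γ : SimpleGraph W} {t : ι → V}
    {t' : ι → W} (ht : ∀ k, e (t k) = t' (π k)) {r : Setoid ι} :
    SimpleGraph.comap e ⁻¹' forests (Γ.comap e) t (r.comap π) = forests Γ t' r :=
  Set.ext fun _ => comap_mem_forests_iff e π ht

end Forests

/-! ### Gluing graphs along terminals -/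

/-- `W` is made of copies `φ i` of `V`, one for each terminal `t i` of `V`. Two of them, `φ i` and
`φ j`, meet in a single vertex: the terminal `j` of the copy `i`, which is the terminal `i` of the
copy `j`. The terminals `φ i (t i)` remain unshared. -/
structure IsGluing {ι V W : Type*} (φ : ι → V → W) (t : ι → V) : Prop where
  injective : ∀ i, Injective (φ i)
  terminal_injective : Injective t
  exists_eq : ∀ w, ∃ i u, φ i u = w
  apply_terminal_comm : ∀ i j, φ i (t j) = φ j (t i)
  eq_terminal : ∀ {i j u v}, i ≠ j → φ i u = φ j v → u = t j ∧ v = t i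

/-- The union of the graphs `T i`, each drawn in its own copy. -/
def glue {ι V W : Type*} (φ : ι → V → W) (T : ι → SimpleGraph V) : SimpleGraph W :=
  ⨆ i, (T i).map (φ i)

/-- How the terminals of all copies are connected in a glued graph, `(i, j)` standing for the
terminal `j` of the copy `i`, if `s i` is the pattern of the graph drawn in the copy `i`. -/
def gluedPattern {ι : Type*} (s : ι → Setoid ι) : Setoid (ι × ι) :=
  Relation.EqvGen.setoid fun x y => x.swap = y ∨ x.1 = y.1 ∧ s x.1 x.2 y.2

theorem gluedPattern_swap {ι : Type*} (s : ι → Setoid ι) (x : ι × ι) :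
    gluedPattern s x x.swap :=
  .rel _ _ (Or.inl rfl)

theorem gluedPattern_of_rel {ι : Type*} {s : ι → Setoid ι} {i j k : ι} (h : s i j k) :
    gluedPattern s (i, j) (i, k) :=
  .rel _ _ (Or.inr ⟨rfl, h⟩)

/-- Forests with the patterns `s i` glue to a forest with the pattern `r`. The last condition says
that no cycle arises, in terms of the numbers of trees. -/
def Compat {ι : Type*} [Fintype ι] (s : ι → Setoid ι) (r : Setoid ι) : Prop :=
  (∀ x, ∃ k, gluedPattern s x (k, k)) ∧ (gluedPattern s).comap (fun k => (k, k)) = r ∧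
    ∑ i, Nat.card (Quotient (s i)) + Nat.card (Sym2 ι) =
      Nat.card (Quotient r) + Nat.card (ι × ι)

namespace IsGluing

variable {ι V W : Type*} {φ : ι → V → W} {t : ι → V} {T : ι → SimpleGraph V}

theorem glue_adj (h : IsGluing φ t) {w w' : W} :
    (glue φ T).Adj w w' ↔ ∃ i u u', (T i).Adj u u' ∧ φ i u = w ∧ φ i u' = w' := by
  simp only [glue, iSup_adj]
  exact exists_congr fun i => map_adj ⟨φ i, h.injective i⟩ (T i) w w'

theorem comap_glue (h : IsGluing φ t) (T : ι → SimpleGraph V) (i : ι) :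
    (glue φ T).comap (φ i) = T i := by
  ext u u'
  rw [comap_adj, h.glue_adj]
  constructor
  · rintro ⟨j, v, v', hadj, hu, hu'⟩
    obtain rfl | hij := eq_or_ne j i
    · rwa [← h.injective _ hu, ← h.injective _ hu']
    · exact absurd ((h.eq_terminal hij hu).1.trans (h.eq_terminal hij hu').1.symm) hadj.ne
  · exact fun hadj => ⟨i, u, u', hadj, rfl, rfl⟩

theorem adj_copy_iff (h : IsGluing φ t) {i : ι} {u u' : V} :
    (glue φ T).Adj (φ i u) (φ i u') ↔ (T i).Adj u u' := by
  rw [← comap_adj, h.comap_glue]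

theorem glue_comap (h : IsGluing φ t) {Γ : SimpleGraph V} {S : SimpleGraph W}
    (hS : S ≤ glue φ fun _ => Γ) : (glue φ fun i => S.comap (φ i)) = S := by
  ext w w'
  rw [h.glue_adj]
  constructor
  · rintro ⟨i, u, u', hadj, rfl, rfl⟩
    exact hadj
  · intro hadj
    obtain ⟨i, u, u', -, rfl, rfl⟩ := h.glue_adj.1 (hS hadj)
    exact ⟨i, u, u', hadj, rfl, rfl⟩

theorem glue_le_glue_iff (h : IsGluing φ t) {S : ι → SimpleGraph V} :
    glue φ T ≤ glue φ S ↔ ∀ i, T i ≤ S i :=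
  ⟨fun hle _ _ _ hadj => h.adj_copy_iff.1 (hle (h.adj_copy_iff.2 hadj)),
    fun hle => iSup_mono fun i => map_monotone _ (hle i)⟩

theorem reachable_copy (h : IsGluing φ t) {i : ι} {u v : V} (huv : (T i).Reachable u v) :
    (glue φ T).Reachable (φ i u) (φ i v) :=
  huv.map ⟨φ i, h.adj_copy_iff.2⟩

theorem exists_reachable_terminal_of_reachable_glue (h : IsGluing φ t) {p j : ι} {w : W}
    (hw : (glue φ T).Reachable (φ p (t j)) w) :
    ∃ q u k, φ q u = w ∧ (T q).Reachable (t k) u ∧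
      gluedPattern (fun i => pattern t (T i)) (p, j) (q, k) := by
  rw [reachable_iff_reflTransGen] at hw
  induction hw with
  | refl => exact ⟨p, t j, j, rfl, .refl _, .refl _⟩
  | tail _ hadj ih =>
    obtain ⟨q, u, k, rfl, hk, hl⟩ := ih
    obtain ⟨q', v, v', hvv', hv, rfl⟩ := h.glue_adj.1 hadj
    obtain rfl | hqq' := eq_or_ne q q'
    · rw [h.injective _ hv] at hvv'
      exact ⟨q, v', k, rfl, hk.trans hvv'.reachable, hl⟩
    · obtain ⟨rfl, rfl⟩ := h.eq_terminal hqq' hv.symm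
      exact ⟨q', v', q, rfl, hvv'.reachable,
        Setoid.trans' _ (Setoid.trans' _ hl (gluedPattern_of_rel hk)) (gluedPattern_swap _ _)⟩

theorem pattern_glue (h : IsGluing φ t) :
    pattern (fun x : ι × ι => φ x.1 (t x.2)) (glue φ T) =
      gluedPattern fun i => pattern t (T i) := by
  refine le_antisymm ?_ (Setoid.eqvGen_le ?_)
  · rintro ⟨p, j⟩ ⟨q, k⟩ hr
    obtain ⟨q', u, l, hu, hl, hpat⟩ := h.exists_reachable_terminal_of_reachable_glue hr
    obtain rfl | hqq' := eq_or_ne q' q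
    · rw [h.injective _ hu] at hl
      exact Setoid.trans' _ hpat (gluedPattern_of_rel hl)
    · obtain ⟨rfl, hk⟩ := h.eq_terminal hqq' hu
      obtain rfl := h.terminal_injective hk
      exact Setoid.trans' _ (Setoid.trans' _ hpat (gluedPattern_of_rel hl)) (gluedPattern_swap _ _)
  · rintro ⟨p, j⟩ ⟨q, k⟩ (hswap | ⟨rfl, hjk⟩)
    · obtain ⟨rfl, rfl⟩ := Prod.ext_iff.1 hswap
      rw [pattern_rel, h.apply_terminal_comm]
      exact .refl _
    · exact h.reachable_copy hjk

theorem forall_reachable_of_glue (h : IsGluing φ t)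
    (hspan : ∀ w, ∃ k, (glue φ T).Reachable w (φ k (t k))) (i : ι) (u : V) :
    ∃ k, (T i).Reachable u (t k) := by
  by_contra! hcon
  have stays_in_copy {w : W} (hw : (glue φ T).Reachable (φ i u) w) :
      ∃ v, φ i v = w ∧ (T i).Reachable u v := by
    rw [reachable_iff_reflTransGen] at hw
    induction hw with
    | refl => exact ⟨u, rfl, .refl _⟩
    | tail _ hadj ih =>
      obtain ⟨v, rfl, huv⟩ := ih
      obtain ⟨j, x, x', hxx', hx, rfl⟩ := h.glue_adj.1 hadj
      obtain rfl | hij := eq_or_ne i j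
      · rw [h.injective _ hx] at hxx'
        exact ⟨x', rfl, huv.trans hxx'.reachable⟩
      · exact absurd ((h.eq_terminal hij hx.symm).1 ▸ huv) (hcon j)
  obtain ⟨k, hk⟩ := hspan (φ i u)
  obtain ⟨v, hv, huv⟩ := stays_in_copy hk
  obtain rfl | hik := eq_or_ne i k
  · exact hcon i (h.injective _ hv ▸ huv)
  · exact hcon k ((h.eq_terminal hik hv).1 ▸ huv)

theorem forall_reachable_glue_iff (h : IsGluing φ t) :
    (∀ w, ∃ k, (glue φ T).Reachable w (φ k (t k))) ↔
      (∀ i u, ∃ k, (T i).Reachable u (t k)) ∧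
        ∀ x, ∃ k, gluedPattern (fun i => pattern t (T i)) x (k, k) := by
  constructor
  · refine fun hspan => ⟨h.forall_reachable_of_glue hspan, fun x => ?_⟩
    rw [← h.pattern_glue]
    exact hspan _
  · rintro ⟨hpieces, hterminals⟩ w
    obtain ⟨i, u, rfl⟩ := h.exists_eq w
    obtain ⟨j, hj⟩ := hpieces i u
    obtain ⟨k, hk⟩ := hterminals (i, j)
    rw [← h.pattern_glue] at hk
    exact ⟨k, (h.reachable_copy hj).trans hk⟩

theorem card_edgeSet_glue [Fintype ι] [Finite V] (h : IsGluing φ t) :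
    Nat.card (glue φ T).edgeSet = ∑ i, Nat.card (T i).edgeSet := by
  have map_mem (i : ι) (e : (T i).edgeSet) : Sym2.map (φ i) e.1 ∈ (glue φ T).edgeSet := by
    obtain ⟨⟨u, v⟩, he⟩ := e
    exact h.adj_copy_iff.2 he
  rw [← Nat.card_sigma]
  refine (Nat.card_eq_of_bijective (fun e : Σ i, (T i).edgeSet =>
    (⟨_, map_mem e.1 e.2⟩ : (glue φ T).edgeSet)) ⟨?_, ?_⟩).symm
  · rintro ⟨i, ⟨⟨u, v⟩, he⟩⟩ ⟨j, ⟨⟨u', v'⟩, he'⟩⟩ heq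
    have heq : Sym2.map (φ i) s(u, v) = Sym2.map (φ j) s(u', v') := congrArg Subtype.val heq
    obtain rfl | hij := eq_or_ne i j
    · obtain heq := Sym2.map.injective (h.injective i) heq
      simp only [heq]
    · have hne : u ≠ v := Adj.ne (G := T i) he
      rcases Sym2.eq_iff.1 heq with ⟨hu, hv⟩ | ⟨hu, hv⟩ <;>
        exact absurd ((h.eq_terminal hij hu).1.trans (h.eq_terminal hij hv).1.symm) hne
  · rintro ⟨⟨w, w'⟩, he⟩
    obtain ⟨i, u, u', hadj, rfl, rfl⟩ := h.glue_adj.1 he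
    exact ⟨⟨i, s(u, u'), hadj⟩, rfl⟩

/-- The vertex of a glued graph that carries the terminals `(i, j)` and `(j, i)`. -/
def junction (h : IsGluing φ t) : Sym2 ι → W :=
  Sym2.lift ⟨fun i j => φ i (t j), h.apply_terminal_comm⟩

theorem junction_injective (h : IsGluing φ t) : Injective h.junction := by
  rintro ⟨i, j⟩ ⟨k, l⟩ (heq : φ i (t j) = φ k (t l))
  refine Sym2.eq_iff.2 ?_
  obtain rfl | hik := eq_or_ne i k
  · rw [h.terminal_injective (h.injective _ heq)]
    exact Or.inl ⟨rfl, rfl⟩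
  · obtain ⟨hj, hl⟩ := h.eq_terminal hik heq
    rw [h.terminal_injective hj, h.terminal_injective hl]
    exact Or.inr ⟨rfl, rfl⟩

theorem bijective_elim_junction (h : IsGluing φ t) :
    Bijective (Sum.elim (fun x : ι × {u // u ∉ Set.range t} => φ x.1 x.2) h.junction) := by
  constructor
  · refine Injective.sumElim ?_ h.junction_injective ?_
    · rintro ⟨i, u, hu⟩ ⟨j, v, hv⟩ (heq : φ i u = φ j v)
      obtain rfl | hij := eq_or_ne i j
      · simp only [h.injective _ heq]
      · exact absurd ⟨j, (h.eq_terminal hij heq).1.symm⟩ hu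
    · rintro ⟨i, u, hu⟩ ⟨j, k⟩ (heq : φ i u = φ j (t k))
      obtain rfl | hij := eq_or_ne i j
      · exact hu ⟨k, (h.injective _ heq).symm⟩
      · exact hu ⟨j, (h.eq_terminal hij heq).1.symm⟩
  · intro w
    obtain ⟨i, u, rfl⟩ := h.exists_eq w
    by_cases hu : u ∈ Set.range t
    · obtain ⟨k, rfl⟩ := hu
      exact ⟨Sum.inr s(i, k), rfl⟩
    · exact ⟨Sum.inl (i, ⟨u, hu⟩), rfl⟩

theorem sum_eq_sum_interior_add_sum_junction [Fintype ι] [Fintype (Sym2 ι)] [Fintype W]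
    [Fintype {u // u ∉ Set.range t}] {M : Type*} [AddCommMonoid M] (h : IsGluing φ t)
    (f : W → M) :
    ∑ w, f w = ∑ i, ∑ u : {u // u ∉ Set.range t}, f (φ i u) + ∑ z, f (h.junction z) := by
  rw [← (Equiv.ofBijective _ h.bijective_elim_junction).sum_comp, Fintype.sum_sum_type,
    Fintype.sum_prod_type]
  rfl

theorem card_add_card_prod [Finite ι] [Finite V] (h : IsGluing φ t) :
    Nat.card W + Nat.card (ι × ι) = Nat.card ι * Nat.card V + Nat.card (Sym2 ι) := by
  classical
  have hV : Nat.card V = Nat.card ι + Nat.card {u // u ∉ Set.range t} := by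
    rw [← Nat.card_range_of_injective h.terminal_injective, ← Nat.card_sum,
      Nat.card_congr (Equiv.sumCompl (· ∈ Set.range t))]
  rw [← Nat.card_eq_of_bijective _ h.bijective_elim_junction, Nat.card_sum, Nat.card_prod,
    Nat.card_prod, hV]
  ring

theorem neighborSet_glue (h : IsGluing φ t) {i : ι} {u : V} (hu : u ∉ Set.range t) :
    (glue φ T).neighborSet (φ i u) = φ i '' (T i).neighborSet u := by
  ext w
  rw [mem_neighborSet, h.glue_adj]
  constructor
  · rintro ⟨j, v, v', hadj, hv, rfl⟩
    obtain rfl | hij := eq_or_ne i j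
    · exact ⟨v', h.injective _ hv ▸ hadj, rfl⟩
    · exact absurd ⟨j, (h.eq_terminal hij hv.symm).1.symm⟩ hu
  · rintro ⟨v, hv, rfl⟩
    exact ⟨i, u, v, hv, rfl, rfl⟩

theorem card_edgeSet_glue_add_eq_iff [Fintype ι] [Finite V] (h : IsGluing φ t) {d : ι → ℕ}
    (hd : ∀ i, Nat.card (T i).edgeSet + d i = Nat.card V) {m : ℕ} :
    Nat.card (glue φ T).edgeSet + m = Nat.card W ↔
      ∑ i, d i + Nat.card (Sym2 ι) = m + Nat.card (ι × ι) := by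
  have hV : ∑ i, Nat.card (T i).edgeSet + ∑ i, d i = Nat.card ι * Nat.card V := by
    simp only [← Finset.sum_add_distrib, hd, Finset.sum_const, Finset.card_univ, smul_eq_mul,
      Nat.card_eq_fintype_card]
  have hW := h.card_add_card_prod
  rw [h.card_edgeSet_glue]
  omega

theorem glue_mem_forests_iff [Fintype ι] [Finite V] (h : IsGluing φ t)
    {Γ : SimpleGraph V} {r : Setoid ι} :
    glue φ T ∈ forests (glue φ fun _ => Γ) (fun k => φ k (t k)) r ↔
      Compat (fun i => pattern t (T i)) r ∧ ∀ i, T i ∈ forests Γ t (pattern t (T i)) := by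
  have : Finite W := .of_surjective _ h.bijective_elim_junction.2
  have pattern_corner : pattern (fun k => φ k (t k)) (glue φ T) =
      (gluedPattern fun i => pattern t (T i)).comap fun k => (k, k) := by
    rw [← h.pattern_glue]
    rfl
  constructor
  · rintro ⟨hle, hacyclic, hspan, hr⟩
    obtain ⟨hpieces, hterminals⟩ := h.forall_reachable_glue_iff.1 hspan
    have hT (i : ι) : T i ∈ forests Γ t (pattern t (T i)) :=
      ⟨h.glue_le_glue_iff.1 hle i, h.comap_glue T i ▸ hacyclic.of_comap ⟨φ i, h.injective i⟩,
        hpieces i, rfl⟩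
    refine ⟨⟨hterminals, pattern_corner ▸ hr, ?_⟩, hT⟩
    exact (h.card_edgeSet_glue_add_eq_iff fun i => (mem_forests_iff_card_edgeSet.1 (hT i)).2.1).1
      (mem_forests_iff_card_edgeSet.1 ⟨hle, hacyclic, hspan, hr⟩).2.1
  · rintro ⟨⟨hterminals, hr, hblocks⟩, hT⟩
    exact mem_forests_iff_card_edgeSet.2 ⟨h.glue_le_glue_iff.2 fun i => (hT i).1,
      (h.card_edgeSet_glue_add_eq_iff fun i =>
        (mem_forests_iff_card_edgeSet.1 (hT i)).2.1).2 hblocks,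
      h.forall_reachable_glue_iff.2 ⟨fun i => (hT i).2.2.1, hterminals⟩, pattern_corner.trans hr⟩

open Classical in
theorem ncard_forests_glue [Fintype ι] [Finite V] (h : IsGluing φ t) {κ : Type*} [Fintype κ]
    (c : κ ≃ Setoid ι) (Γ : SimpleGraph V) (P : ι → SimpleGraph V → Prop) (r : Setoid ι) :
    {T ∈ forests (glue φ fun _ => Γ) (fun k => φ k (t k)) r | ∀ i, P i (T.comap (φ i))}.ncard =
      ∑ s : ι → κ with Compat (c ∘ s) r,
        ∏ i, {T ∈ forests Γ t (c (s i)) | P i T}.ncard := by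
  let Pieces := Σ s : {s : ι → κ // Compat (c ∘ s) r},
    ∀ i, {T ∈ forests Γ t (c (s.1 i)) | P i T}
  have pattern_eq (x : Pieces) : (fun i => pattern t (x.2 i).1) = fun i => c (x.1.1 i) :=
    funext fun i => (x.2 i).2.1.2.2.2
  have glue_mem (x : Pieces) : (glue φ fun i => (x.2 i).1) ∈
      {T ∈ forests (glue φ fun _ => Γ) (fun k => φ k (t k)) r | ∀ i, P i (T.comap (φ i))} := by
    refine ⟨h.glue_mem_forests_iff.2 ⟨pattern_eq x ▸ x.1.2, fun i => ?_⟩, fun i => ?_⟩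
    · rw [congrFun (pattern_eq x) i]
      exact (x.2 i).2.1
    · rw [h.comap_glue]
      exact (x.2 i).2.2
  have hbij : Bijective fun x : Pieces => (⟨_, glue_mem x⟩ :
      {T ∈ forests (glue φ fun _ => Γ) (fun k => φ k (t k)) r | ∀ i, P i (T.comap (φ i))}) := by
    constructor
    · intro x y hxy
      have glue_eq : (glue φ fun i => (x.2 i).1) = glue φ fun i => (y.2 i).1 :=
        congrArg Subtype.val hxy
      have pieces_eq (i : ι) : (x.2 i).1 = (y.2 i).1 := by
        rw [← h.comap_glue (fun i => (x.2 i).1) i, glue_eq, h.comap_glue]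
      have patterns_eq : x.1 = y.1 := Subtype.ext <| funext fun i => c.injective <| by
        rw [← congrFun (pattern_eq x) i, ← congrFun (pattern_eq y) i, pieces_eq]
      obtain ⟨s, T⟩ := x
      obtain ⟨s', T'⟩ := y
      obtain rfl : s = s' := patterns_eq
      exact congrArg _ (funext fun i => Subtype.ext (pieces_eq i))
    · rintro ⟨T, hT, hP⟩
      have hglue := h.glue_comap hT.1
      obtain ⟨hcompat, hpieces⟩ := h.glue_mem_forests_iff.1 (hglue.symm ▸ hT)
      exact ⟨⟨⟨fun i => c.symm (pattern t (T.comap (φ i))), by simpa [comp_def] using hcompat⟩,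
        fun i => ⟨T.comap (φ i), by simpa using hpieces i, hP i⟩⟩, Subtype.ext hglue⟩
  rw [← Nat.card_coe_set_eq, ← Nat.card_eq_of_bijective _ hbij, Nat.card_sigma]
  simp only [Nat.card_pi, Nat.card_coe_set_eq]
  exact (Finset.sum_subtype (p := fun s : ι → κ => Compat (c ∘ s) r) _ (by simp)
    fun s => ∏ i, {T ∈ forests Γ t (c (s i)) | P i T}.ncard).symm

end IsGluing

/-! ### Gluing three pieces -/

/-- The function whose level sets are the blocks of the partition number `r` of three terminals.
The partitions are numbered in the order of the columns of `matL`: first the trivial one, then those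
in which `2`, `1` and `0` is alone, finally the discrete one. -/
def label : Fin 5 → Fin 3 → Fin 3 :=
  ![![0, 0, 0], ![0, 0, 1], ![0, 1, 0], ![0, 1, 1], ![0, 1, 2]]

theorem label_eq_label_iff_injective {r r' : Fin 5}
    (h : ∀ i j, label r i = label r j ↔ label r' i = label r' j) : r = r' := by
  revert r r'
  decide

theorem exists_label_eq_label_iff (s : Setoid (Fin 3)) :
    ∃ r, ∀ i j, label r i = label r j ↔ s i j := by
  have h10 : s 1 0 ↔ s 0 1 := s.comm'
  have h20 : s 2 0 ↔ s 0 2 := s.comm'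
  have h21 : s 2 1 ↔ s 1 2 := s.comm'
  by_cases h01 : s 0 1
  · have h12 : s 1 2 ↔ s 0 2 := ⟨s.trans' h01, s.trans' (s.symm' h01)⟩
    by_cases h02 : s 0 2
    · exact ⟨0, by simp [Fin.forall_fin_succ, label, *]⟩
    · exact ⟨1, by simp [Fin.forall_fin_succ, label, *]⟩
  · by_cases h02 : s 0 2
    · have h12 : ¬ s 1 2 := fun h => h01 (s.trans' h02 (s.symm' h))
      exact ⟨2, by simp [Fin.forall_fin_succ, label, *]⟩
    · by_cases h12 : s 1 2
      · exact ⟨3, by simp [Fin.forall_fin_succ, label, *]⟩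
      · exact ⟨4, by simp [Fin.forall_fin_succ, label, *]⟩

/-- The partitions of three terminals, in the order of `label`. -/
noncomputable def partition : Fin 5 ≃ Setoid (Fin 3) :=
  Equiv.ofBijective (fun r => Setoid.ker (label r))
    ⟨fun _ _ h => label_eq_label_iff_injective (Setoid.ext_iff.1 h), fun s =>
      (exists_label_eq_label_iff s).imp fun _ h => Setoid.ext h⟩

theorem partition_rel {r : Fin 5} {i j : Fin 3} : partition r i j ↔ label r i = label r j :=
  Iff.rfl

/-- The number of blocks of the partition `r`. -/
def blocks : Fin 5 → ℕ := ![1, 2, 2, 2, 3]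

theorem card_quotient_partition (r : Fin 5) : Nat.card (Quotient (partition r)) = blocks r := by
  refine (Nat.card_congr (Setoid.quotientKerEquivRange (label r))).trans ?_
  rw [Nat.card_eq_fintype_card]
  revert r
  decide

/-- The terminal `x` of a glued graph (encoded as in `gluedPattern`) is reached from its
terminal `(i, i)` through at most `n` copies with the patterns `s`. -/
def linked (s : Fin 3 → Fin 5) (i : Fin 3) : ℕ → Fin 3 × Fin 3 → Bool
  | 0, (p, j) => p = i && j = i
  | n + 1, (p, j) =>
    label (s p) 0 = label (s p) j && linked s i n (0, p) ||
    label (s p) 1 = label (s p) j && linked s i n (1, p) ||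
    label (s p) 2 = label (s p) j && linked s i n (2, p)

theorem linked_succ {s : Fin 3 → Fin 5} {i : Fin 3} {n : ℕ} {x : Fin 3 × Fin 3} :
    linked s i (n + 1) x ↔ ∃ k, partition (s x.1) k x.2 ∧ linked s i n (k, x.1) := by
  simp [linked, partition_rel, Fin.exists_fin_succ, or_assoc]

theorem forall_fin_three_fun {α : Type*} {P : (Fin 3 → α) → Prop} (h : ∀ a b c, P ![a, b, c])
    (s : Fin 3 → α) : P s := by
  have : s = ![s 0, s 1, s 2] := by ext i; fin_cases i <;> rfl
  rw [this]
  exact h _ _ _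

-- Closedness under the identification of `(p, j)` with `(j, p)` shows that four steps reach all
-- that can be reached.
theorem linked_four_swap : ∀ (s : Fin 3 → Fin 5) (i : Fin 3) (x : Fin 3 × Fin 3),
    linked s i 4 x.swap = linked s i 4 x :=
  forall_fin_three_fun (by decide +kernel)

theorem linked_self (s : Fin 3 → Fin 5) (i : Fin 3) (n : ℕ) : linked s i n (i, i) := by
  induction n with
  | zero => simp [linked]
  | succ n ih => exact linked_succ.2 ⟨i, Setoid.refl' _ i, ih⟩

theorem gluedPattern_of_linked {s : Fin 3 → Fin 5} {i : Fin 3} {n : ℕ} {x : Fin 3 × Fin 3}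
    (h : linked s i n x) : gluedPattern (partition ∘ s) (i, i) x := by
  induction n generalizing x with
  | zero =>
    obtain rfl : x = (i, i) := Prod.ext_iff.2 (by simpa [linked] using h)
    exact Setoid.refl' _ _
  | succ n ih =>
    obtain ⟨k, hk, hn⟩ := linked_succ.1 h
    exact Setoid.trans' _ (ih hn) (Setoid.trans' _ (gluedPattern_swap _ _) (gluedPattern_of_rel hk))

theorem gluedPattern_iff_linked {s : Fin 3 → Fin 5} {i : Fin 3} {x : Fin 3 × Fin 3} :
    gluedPattern (partition ∘ s) (i, i) x ↔ linked s i 4 x := by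
  refine ⟨fun h => ?_, gluedPattern_of_linked⟩
  have linked_eq : gluedPattern (partition ∘ s) ≤ Setoid.ker (linked s i 4) := by
    have step {x y : Fin 3 × Fin 3} (hfst : x.1 = y.1) (h : partition (s x.1) x.2 y.2) :
        linked s i 4 x → linked s i 4 y := fun hx => by
      obtain ⟨k, hk, hn⟩ := linked_succ.1 hx
      exact linked_succ.2 ⟨k, hfst ▸ hk.trans h, hfst ▸ hn⟩
    refine Setoid.eqvGen_le ?_
    rintro x y (rfl | ⟨hfst, h⟩)
    · exact (linked_four_swap s i x).symm
    · exact Bool.eq_iff_iff.2 ⟨step hfst h, step hfst.symm (hfst ▸ h.symm)⟩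
  exact (linked_eq h).symm.trans (linked_self s i 4)

theorem compat_partition_iff {s : Fin 3 → Fin 5} {r : Fin 5} :
    Compat (partition ∘ s) (partition r) ↔
      blocks (s 0) + blocks (s 1) + blocks (s 2) = blocks r + 3 ∧
        (∀ i j, linked s i 4 (j, j) ↔ label r i = label r j) ∧ ∀ x, ∃ i, linked s i 4 x := by
  have card_sym2 : Nat.card (Sym2 (Fin 3)) = 6 := by
    rw [Nat.card_eq_fintype_card]
    rfl
  have card_prod : Nat.card (Fin 3 × Fin 3) = 9 := by simp
  rw [Compat, Setoid.ext_iff, card_sym2, card_prod, and_comm, and_right_comm, and_comm]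
  refine and_congr ?_ (and_congr ?_ (forall_congr' fun x => exists_congr fun i => ?_))
  · simp only [Function.comp_apply, card_quotient_partition, Fin.sum_univ_three]
    omega
  · simp only [Setoid.comap_rel, gluedPattern_iff_linked, partition_rel]
  · rw [Setoid.comm', gluedPattern_iff_linked]

instance (s : Fin 3 → Fin 5) (r : Fin 5) :
    Decidable (Compat (partition ∘ s) (partition r)) :=
  decidable_of_iff' _ compat_partition_iff

/-- A number proportional to the number of forests of the gasket with the pattern `r`, up to a
factor that depends only on the number of blocks of `r`. -/
def weight : Fin 5 → ℕ := ![1, 1, 1, 1, 3]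

/-- The weighted number of ways to glue three forests to one with the pattern `r`. -/
def totalWeight (r : Fin 5) : ℕ :=
  ∑ s : Fin 3 → Fin 5 with Compat (partition ∘ s) (partition r), ∏ k, weight (s k)

theorem totalWeight_eq : totalWeight = ![6, 10, 10, 10, 50] := by
  decide +kernel

/-- The entry `(q, r)` is the weighted proportion, among all ways to glue three forests to one with
the pattern `r`, of those in which the forest in the copy `i` has the pattern `q`. -/
def transfer (i : Fin 3) : Matrix (Fin 5) (Fin 5) ℚ := .of fun q r =>
  (∑ s : Fin 3 → Fin 5 with s i = q ∧ Compat (partition ∘ s) (partition r),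
    ∏ k, weight (s k) : ℕ) / totalWeight r

theorem transfer_zero : transfer 0 = .swap ℚ 2 3 * matR * .swap ℚ 2 3 := by
  simp only [transfer, totalWeight_eq]
  decide +kernel

theorem transfer_one : transfer 1 = matR := by
  simp only [transfer, totalWeight_eq]
  decide +kernel

theorem transfer_two : transfer 2 = .swap ℚ 1 2 * matR * .swap ℚ 1 2 := by
  simp only [transfer, totalWeight_eq]
  decide +kernel

instance decidableRelAdjMk' {V : Type*}
    (a : {adj : V → V → Bool // (∀ x y, adj x y = adj y x) ∧ ∀ x, ¬ adj x x}) :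
    DecidableRel (SimpleGraph.mk' a).Adj :=
  fun x y => inferInstanceAs (Decidable (a.1 x y))

theorem pattern_eq_partition_iff {V : Type*} {t : Fin 3 → V} {T : SimpleGraph V} {r : Fin 5} :
    pattern t T = partition r ↔
      ∀ i j, T.Reachable (t i) (t j) ↔ label r i = label r j :=
  Setoid.ext_iff

theorem ncard_forests_top (r : Fin 5) :
    (forests (⊤ : SimpleGraph (Fin 3)) id (partition r)).ncard = ![3, 1, 1, 1, 1] r := by
  have himage : forests (⊤ : SimpleGraph (Fin 3)) id (partition r) = SimpleGraph.mk' ''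
      ↑({a | (SimpleGraph.mk' a).edgeFinset.card + blocks r = 3 ∧
        ∀ i j, (SimpleGraph.mk' a).Reachable i j ↔ label r i = label r j} :
          Finset {adj : Fin 3 → Fin 3 → Bool // (∀ x y, adj x y = adj y x) ∧ ∀ x, ¬ adj x x}) := by
    ext T
    obtain ⟨a, -, rfl⟩ := Finset.mem_map.1 (Finset.mem_univ T)
    rw [SimpleGraph.mk'.injective.mem_set_image, mem_forests_iff_card_edgeSet,
      pattern_eq_partition_iff, card_quotient_partition, Nat.card_eq_card_toFinset,
      Nat.card_eq_fintype_card, Fintype.card_fin]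
    simpa [edgeFinset] using fun _ _ v => ⟨v, .refl v⟩
  rw [himage, Set.ncard_image_of_injective _ SimpleGraph.mk'.injective, Set.ncard_coe_finset]
  clear himage
  revert r
  decide +kernel

/-! ### The gasket -/

/-- The outmost vertices `o`, `a_n`, `b_n` of `SG(n)`. -/
def corner (n : ℕ) : Fin 3 → Vert n := ![o n, rightmost n, topmost n]

/-- The translations that carry `SG(n)` to its three copies in `SG(n + 1)`. -/
def offset (n : ℕ) : Fin 3 → ℕ × ℕ := ![0, (2 ^ n, 0), (0, 2 ^ n)]

theorem add_offset_mem {n : ℕ} (i : Fin 3) {v : ℕ × ℕ} (hv : v ∈ verts n) :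
    v + offset n i ∈ verts (n + 1) := by
  rw [mem_verts_succ]
  fin_cases i
  · exact Or.inl (by simpa [offset] using hv)
  · exact Or.inr (Or.inl ⟨v, hv, rfl⟩)
  · exact Or.inr (Or.inr ⟨v, hv, rfl⟩)

/-- The three copies of `SG(n)` in `SG(n + 1)`. -/
def copy (n : ℕ) (i : Fin 3) (x : Vert n) : Vert (n + 1) :=
  ⟨x.1 + offset n i, add_offset_mem i x.2⟩

theorem vert_ext_iff {n : ℕ} {x y : Vert n} : x = y ↔ x.1.1 = y.1.1 ∧ x.1.2 = y.1.2 := by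
  rw [Subtype.ext_iff, Prod.ext_iff]

theorem corner_injective (n : ℕ) : Injective (corner n) := by
  intro i j h
  have hpos : 0 < 2 ^ n := Nat.two_pow_pos n
  rw [Subtype.ext_iff] at h
  fin_cases i <;> fin_cases j <;> simp [corner, o, rightmost, topmost, hpos.ne] at h ⊢

theorem corner_zero_surjective : Surjective (corner 0) := by
  rintro ⟨x, hx⟩
  simp only [verts, Finset.mem_insert, Finset.mem_singleton] at hx
  rcases hx with rfl | rfl | rfl
  exacts [⟨0, rfl⟩, ⟨1, rfl⟩, ⟨2, rfl⟩]

theorem isGluing_copy (n : ℕ) : IsGluing (copy n) (corner n) where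
  injective i x y h := by
    rw [vert_ext_iff] at h ⊢
    simpa [copy] using h
  terminal_injective := corner_injective n
  exists_eq w := by
    rcases mem_verts_succ.1 w.2 with h | ⟨v, h, hv⟩ | ⟨v, h, hv⟩
    · exact ⟨0, ⟨w.1, h⟩, Subtype.ext (by simp [copy, offset])⟩
    · exact ⟨1, ⟨v, h⟩, Subtype.ext hv⟩
    · exact ⟨2, ⟨v, h⟩, Subtype.ext hv⟩
  apply_terminal_comm i j := by
    fin_cases i <;> fin_cases j <;>
      simp [copy, corner, o, rightmost, topmost, offset]
  eq_terminal := by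
    intro i j u v hij h
    have hu := add_le_of_mem u.2
    have hv := add_le_of_mem v.2
    rw [vert_ext_iff] at h
    rw [vert_ext_iff, vert_ext_iff]
    fin_cases i <;> fin_cases j <;>
      simp [copy, corner, o, rightmost, topmost, offset] at h hij ⊢ <;> omega

theorem corner_succ (n : ℕ) : corner (n + 1) = fun k => copy n k (corner n k) := by
  ext1 k
  fin_cases k <;>
    simp [copy, corner, o, rightmost, topmost, offset, pow_succ, mul_two]

theorem lacunary_eq (n : ℕ) : lacunary n =
    ![copy n 0 (corner n 1), copy n 0 (corner n 2), copy n 1 (corner n 2)] := by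
  ext1 k
  fin_cases k <;>
    simp [copy, corner, rightmost, topmost, offset, lacunary]

theorem latticeGraph_succ_adj {n : ℕ} {u v : ℕ × ℕ} : (latticeGraph (n + 1)).Adj u v ↔
    ∃ i u' v', (latticeGraph n).Adj u' v' ∧ u' + offset n i = u ∧ v' + offset n i = v := by
  have map_adj_iff (c : ℕ × ℕ) : ((latticeGraph n).map (· + c)).Adj u v ↔
      ∃ u' v', (latticeGraph n).Adj u' v' ∧ u' + c = u ∧ v' + c = v :=
    map_adj (addRightEmbedding c) _ _ _
  have map_zero : (latticeGraph n).map (· + (0 : ℕ × ℕ)) = latticeGraph n := by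
    simp only [add_zero]
    exact map_id _
  have succ_eq : latticeGraph (n + 1) = (latticeGraph n).map (· + (0 : ℕ × ℕ)) ⊔
      (latticeGraph n).map (· + (2 ^ n, 0)) ⊔ (latticeGraph n).map (· + (0, 2 ^ n)) := by
    rw [map_zero, latticeGraph]
  rw [succ_eq, sup_adj, sup_adj, map_adj_iff, map_adj_iff, map_adj_iff, or_assoc,
    Fin.exists_fin_succ, Fin.exists_fin_two]
  rfl

theorem mem_verts_of_adj {n : ℕ} {u v : ℕ × ℕ} (h : (latticeGraph n).Adj u v) : u ∈ verts n := by
  induction n generalizing u v with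
  | zero =>
    simp only [latticeGraph, fromEdgeSet_adj, Set.mem_insert_iff, Set.mem_singleton_iff,
      Sym2.eq_iff] at h
    rcases h with ⟨(⟨rfl, rfl⟩ | ⟨rfl, rfl⟩) | (⟨rfl, rfl⟩ | ⟨rfl, rfl⟩) | ⟨rfl, rfl⟩ |
      ⟨rfl, rfl⟩, -⟩ <;> decide
  | succ n ih =>
    obtain ⟨i, u', v', hadj, rfl, rfl⟩ := latticeGraph_succ_adj.1 h
    exact add_offset_mem i (ih hadj)

theorem SG_succ (n : ℕ) : SG (n + 1) = glue (copy n) fun _ => SG n := by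
  ext x y
  rw [(isGluing_copy n).glue_adj]
  constructor
  · intro h
    obtain ⟨i, u', v', hadj, hu, hv⟩ := latticeGraph_succ_adj.1 h
    exact ⟨i, ⟨u', mem_verts_of_adj hadj⟩, ⟨v', mem_verts_of_adj hadj.symm⟩, hadj,
      Subtype.ext hu, Subtype.ext hv⟩
  · rintro ⟨i, u, v, hadj, rfl, rfl⟩
    exact latticeGraph_succ_adj.2 ⟨i, u.1, v.1, hadj, rfl, rfl⟩

theorem SG_zero : SG 0 = ⊤ := by
  ext ⟨x, hx⟩ ⟨y, hy⟩
  simp only [verts, Finset.mem_insert, Finset.mem_singleton] at hx hy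
  rcases hx with rfl | rfl | rfl <;> rcases hy with rfl | rfl | rfl <;>
    simp [SG, latticeGraph]

/-- The spanning forests of `SG(n)` each of whose trees contains a corner, and which join the
corners according to the partition number `r`. -/
def gasketForests (n : ℕ) (r : Fin 5) : Set (SimpleGraph (Vert n)) :=
  forests (SG n) (corner n) (partition r)

theorem mem_gasketForests_iff {n : ℕ} {r : Fin 5} {T : SimpleGraph (Vert n)} :
    T ∈ gasketForests n r ↔ T ≤ SG n ∧ T.IsAcyclic ∧ Nat.card T.ConnectedComponent = blocks r ∧
      (T.Reachable (o n) (rightmost n) ↔ label r 0 = label r 1) ∧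
      (T.Reachable (o n) (topmost n) ↔ label r 0 = label r 2) ∧
      (T.Reachable (rightmost n) (topmost n) ↔ label r 1 = label r 2) := by
  rw [gasketForests, mem_forests_iff_card_connectedComponent, pattern_eq_partition_iff,
    card_quotient_partition]
  refine and_congr_right fun _ => and_congr_right fun _ => and_congr_right fun _ =>
    ⟨fun h => ⟨h 0 1, h 0 2, h 1 2⟩, fun ⟨h01, h02, h12⟩ i j => ?_⟩
  have reachable_symm (i j) : T.Reachable (corner n i) (corner n j) ↔
    T.Reachable (corner n j) (corner n i) := reachable_comm
  have label_symm (i j) : label r i = label r j ↔ label r j = label r i := eq_comm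
  fin_cases i <;> fin_cases j
  exacts [iff_of_true (.refl _) rfl, h01, h02,
    (reachable_symm _ _).trans (h01.trans (label_symm _ _)),
    iff_of_true (.refl _) rfl, h12, (reachable_symm _ _).trans (h02.trans (label_symm _ _)),
    (reachable_symm _ _).trans (h12.trans (label_symm _ _)), iff_of_true (.refl _) rfl]

theorem treeSet_eq (n : ℕ) : treeSet n = gasketForests n 0 := by
  ext T
  rw [mem_gasketForests_iff, treeSet, Set.mem_ofPred_eq, isTree_iff,
    and_comm (a := T.Connected)]
  refine and_congr_right fun _ => and_congr_right fun _ => ⟨fun h => ?_, fun ⟨h, _⟩ => ?_⟩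
  · have hsub := h.preconnected.subsingleton_connectedComponent
    refine ⟨Nat.card_eq_one_iff_unique.2 ⟨hsub, ⟨T.connectedComponentMk (o n)⟩⟩, ?_⟩
    simp [label, h.preconnected _ _]
  · have hsub : Subsingleton T.ConnectedComponent := (Nat.card_eq_one_iff_unique.1 h).1
    exact (connected_iff _).2
      ⟨fun u v => ConnectedComponent.exact (Subsingleton.elim _ _), ⟨o n⟩⟩

theorem twoTreeSet_eq (n : ℕ) : twoTreeSet n = gasketForests n 1 := by
  ext T
  have not_reachable (h : T.Reachable (o n) (rightmost n)) :
      ¬ T.Reachable (o n) (topmost n) ↔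
        ¬ T.Reachable (o n) (topmost n) ∧ ¬ T.Reachable (rightmost n) (topmost n) :=
    ⟨fun h' => ⟨h', fun h'' => h' (h.trans h'')⟩, And.left⟩
  simpa [mem_gasketForests_iff, twoTreeSet, label, blocks] using fun _ _ _ => not_reachable

theorem threeTreeSet_eq (n : ℕ) : threeTreeSet n = gasketForests n 4 := by
  ext T
  simp [mem_gasketForests_iff, threeTreeSet, label, blocks]

/-! ### Counting forests -/

theorem ncard_preimage_comap {V W : Type*} (e : V ≃ W) (S : Set (SimpleGraph V)) :
    (SimpleGraph.comap e ⁻¹' S).ncard = S.ncard := by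
  have hbij : Bijective (SimpleGraph.comap (V := V) e) := e.symm.simpleGraph.bijective
  exact Set.ncard_preimage_of_injective_subset_range hbij.injective
    (hbij.surjective.range_eq ▸ Set.subset_univ S)

theorem ncard_gasketForests_zero (r : Fin 5) :
    (gasketForests 0 r).ncard = ![3, 1, 1, 1, 1] r := by
  let e : Fin 3 ≃ Vert 0 := .ofBijective (corner 0) ⟨corner_injective 0, corner_zero_surjective⟩
  have htop : (SG 0).comap e = ⊤ := by
    rw [SG_zero, SimpleGraph.comap_top e.injective]
  have hpreimage : gasketForests 0 r =
      SimpleGraph.comap e ⁻¹' forests (⊤ : SimpleGraph (Fin 3)) id (partition r) :=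
    htop ▸ (preimage_comap_forests e (.refl _) fun _ => rfl).symm
  rw [hpreimage, ncard_preimage_comap, ncard_forests_top]

theorem ncard_gasketForests_succ (n : ℕ) (P : Fin 3 → SimpleGraph (Vert n) → Prop) (r : Fin 5) :
    {T ∈ gasketForests (n + 1) r | ∀ i, P i (T.comap (copy n i))}.ncard =
      ∑ s : Fin 3 → Fin 5 with Compat (partition ∘ s) (partition r),
        ∏ i, {T ∈ gasketForests n (s i) | P i T}.ncard := by
  simp only [gasketForests, SG_succ, corner_succ]
  convert (isGluing_copy n).ncard_forests_glue partition (SG n) P (partition r)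

theorem prod_weight_geometric {A ρ : ℚ} {s : Fin 3 → Fin 5} {r : Fin 5}
    (h : Compat (partition ∘ s) (partition r)) :
    ∏ k, (weight (s k) * A * ρ ^ blocks (s k)) =
      (∏ k, weight (s k) : ℕ) * (A ^ 3 * ρ ^ 3 * ρ ^ blocks r) := by
  have hblocks : ∑ k, blocks (s k) = 3 + blocks r := by
    rw [Fin.sum_univ_three, (compat_partition_iff.1 h).1, add_comm]
  rw [Finset.prod_mul_distrib, Finset.prod_mul_distrib, Finset.prod_pow_eq_pow_sum, hblocks,
    Finset.prod_const, Finset.card_fin, pow_add, Nat.cast_prod]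
  ring

theorem ncard_gasketForests_succ_of_geometric {n : ℕ} {A ρ : ℚ}
    (h : ∀ q, ((gasketForests n q).ncard : ℚ) = weight q * A * ρ ^ blocks q) (r : Fin 5) :
    ((gasketForests (n + 1) r).ncard : ℚ) = totalWeight r * (A ^ 3 * ρ ^ 3 * ρ ^ blocks r) := by
  have hsum := ncard_gasketForests_succ n (fun _ _ => True) r
  simp only [implies_true, and_true, Set.ofPred_mem_eq] at hsum
  rw [hsum, totalWeight, Nat.cast_sum, Nat.cast_sum, Finset.sum_mul]
  refine Finset.sum_congr rfl fun s hs => ?_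
  rw [Nat.cast_prod, ← prod_weight_geometric (Finset.mem_filter.1 hs).2]
  simp only [h]

theorem exists_ncard_gasketForests_eq (n : ℕ) : ∃ A ρ : ℚ, 0 < A ∧ 0 < ρ ∧
    ∀ q, ((gasketForests n q).ncard : ℚ) = weight q * A * ρ ^ blocks q := by
  induction n with
  | zero =>
    refine ⟨9, 1 / 3, by norm_num, by norm_num, fun q => ?_⟩
    rw [ncard_gasketForests_zero]
    fin_cases q <;> norm_num [weight, blocks]
  | succ n ih =>
    obtain ⟨A, ρ, hA, hρ, h⟩ := ih
    have htotal (q : Fin 5) : (totalWeight q : ℚ) = weight q * (18 / 5) * (5 / 3) ^ blocks q := by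
      rw [totalWeight_eq]
      fin_cases q <;> norm_num [weight, blocks]
    refine ⟨18 / 5 * (A ^ 3 * ρ ^ 3), 5 / 3 * ρ, by positivity, by positivity, fun q => ?_⟩
    rw [ncard_gasketForests_succ_of_geometric h, htotal]
    ring

/-! ### Degrees -/

/-- The probabilities that the vertex `x` of `SG(n)` has degree `j` in a random forest of each of
the five patterns. -/
noncomputable def probRow (j n : ℕ) (x : Vert n) : Fin 5 → ℚ :=
  fun r => degProb (gasketForests n r) j x

theorem ncard_degree_copy (j n : ℕ) (i : Fin 3) {x : Vert n} (hx : x ∉ Set.range (corner n))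
    (r : Fin 5) :
    {T ∈ gasketForests (n + 1) r | (T.neighborSet (copy n i x)).ncard = j}.ncard =
      ∑ s : Fin 3 → Fin 5 with Compat (partition ∘ s) (partition r),
        ∏ k, {T ∈ gasketForests n (s k) | k = i → (T.neighborSet x).ncard = j}.ncard := by
  have hglue := isGluing_copy n
  rw [← ncard_gasketForests_succ n fun k T => k = i → (T.neighborSet x).ncard = j]
  congr 1
  ext T
  refine and_congr_right fun hT => ?_
  have hle : T ≤ glue (copy n) fun _ => SG n := SG_succ n ▸ hT.1
  have hneighbors := hglue.neighborSet_glue (T := fun k => T.comap (copy n k)) (i := i) hx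
  rw [hglue.glue_comap hle] at hneighbors
  rw [forall_eq, hneighbors, Set.ncard_image_of_injective _ (hglue.injective i)]

theorem prod_ncard_degree (j : ℕ) {n : ℕ} (i : Fin 3) (x : Vert n) {s : Fin 3 → Fin 5}
    (h : (gasketForests n (s i)).ncard ≠ 0) :
    ∏ k, ({T ∈ gasketForests n (s k) | k = i → (T.neighborSet x).ncard = j}.ncard : ℚ) =
      probRow j n x (s i) * ∏ k, ((gasketForests n (s k)).ncard : ℚ) := by
  rw [← Finset.mul_prod_erase _ _ (Finset.mem_univ i),
    ← Finset.mul_prod_erase _ (fun k => ((gasketForests n (s k)).ncard : ℚ)) (Finset.mem_univ i),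
    ← mul_assoc, probRow, degProb, div_mul_cancel₀ _ (Nat.cast_ne_zero.2 h)]
  congr 1
  · simp only [forall_const]
  · refine Finset.prod_congr rfl fun k hk => ?_
    simp only [Finset.ne_of_mem_erase hk, false_imp_iff, and_true, Set.ofPred_mem_eq]

theorem totalWeight_ne_zero (r : Fin 5) : totalWeight r ≠ 0 := by
  rw [totalWeight_eq]
  revert r
  decide

theorem sum_compat_mul_prod_weight (v : Fin 5 → ℚ) (i : Fin 3) (r : Fin 5) :
    ∑ s : Fin 3 → Fin 5 with Compat (partition ∘ s) (partition r),
      v (s i) * (∏ k, weight (s k) : ℕ) = (v ᵥ* transfer i) r * totalWeight r := by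
  have htotal : (totalWeight r : ℚ) ≠ 0 := Nat.cast_ne_zero.2 (totalWeight_ne_zero r)
  rw [← Finset.sum_fiberwise _ fun s => s i, vecMul, dotProduct, Finset.sum_mul]
  refine Finset.sum_congr rfl fun q _ => ?_
  rw [transfer, of_apply, mul_assoc, div_mul_cancel₀ _ htotal, Nat.cast_sum, Finset.mul_sum,
    Finset.filter_filter]
  refine Finset.sum_congr (Finset.filter_congr fun s _ => and_comm) fun s hs => ?_
  rw [(Finset.mem_filter.1 hs).2.1]

theorem probRow_copy (j n : ℕ) (i : Fin 3) {x : Vert n} (hx : x ∉ Set.range (corner n)) :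
    probRow j (n + 1) (copy n i x) = probRow j n x ᵥ* transfer i := by
  obtain ⟨A, ρ, hA, hρ, hcard⟩ := exists_ncard_gasketForests_eq n
  have hweight (q : Fin 5) : 0 < weight q := by revert q; decide
  have hne (q : Fin 5) : (gasketForests n q).ncard ≠ 0 := by
    have := hweight q
    rw [← Nat.cast_ne_zero (R := ℚ), hcard]
    positivity
  ext r
  have htotal : (totalWeight r : ℚ) ≠ 0 := Nat.cast_ne_zero.2 (totalWeight_ne_zero r)
  rw [probRow, degProb, ncard_gasketForests_succ_of_geometric hcard, div_eq_iff (by positivity),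
    ← mul_assoc, ← sum_compat_mul_prod_weight, Finset.sum_mul, ncard_degree_copy j n i hx,
    Nat.cast_sum]
  refine Finset.sum_congr rfl fun s hs => ?_
  rw [Nat.cast_prod, prod_ncard_degree j i x (hne _), mul_assoc,
    ← prod_weight_geometric (Finset.mem_filter.1 hs).2]
  simp only [hcard]

/-! ### Reflections -/

theorem degProb_preimage_comap {V W : Type} (e : V ≃ W) (S : Set (SimpleGraph V)) (j : ℕ) (x : V) :
    degProb (SimpleGraph.comap e ⁻¹' S) j (e x) = degProb S j x := by
  have hdegree (T : SimpleGraph W) :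
      ((T.comap e).neighborSet x).ncard = (T.neighborSet (e x)).ncard :=
    Set.ncard_preimage_of_injective_subset_range e.injective
      (e.surjective.range_eq ▸ Set.subset_univ _)
  have hsep : {T ∈ SimpleGraph.comap e ⁻¹' S | (T.neighborSet (e x)).ncard = j} =
      SimpleGraph.comap e ⁻¹' {T ∈ S | (T.neighborSet x).ncard = j} :=
    Set.ext fun T => and_congr_right fun _ => by rw [hdegree]
  rw [degProb, hsep, ncard_preimage_comap, ncard_preimage_comap, degProb]

theorem probRow_apply_of_comap {n : ℕ} (e : Vert n ≃ Vert n) (hSG : (SG n).comap e = SG n)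
    (π : Equiv.Perm (Fin 3)) (hcorner : ∀ k, e (corner n k) = corner n (π k))
    {r r' : Fin 5} (hr : (partition r').comap π = partition r) (j : ℕ) (x : Vert n) :
    probRow j n (e x) r' = probRow j n x r := by
  have hpreimage : SimpleGraph.comap e ⁻¹' gasketForests n r = gasketForests n r' := by
    have := preimage_comap_forests (Γ := SG n) e π hcorner (r := partition r')
    rwa [hSG, hr] at this
  rw [probRow, ← hpreimage, degProb_preimage_comap, probRow]

theorem comap_SG_of_copy (ρ : ∀ n, Vert n → Vert n) (hρ : ∀ n, Involutive (ρ n))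
    {π : Fin 3 → Fin 3} (hcopy : ∀ n i x, ρ (n + 1) (copy n i x) = copy n (π i) (ρ n x)) (n : ℕ) :
    (SG n).comap (ρ n) = SG n := by
  have adj_apply (x y : Vert n) (hxy : (SG n).Adj x y) : (SG n).Adj (ρ n x) (ρ n y) := by
    induction n with
    | zero =>
      rw [SG_zero] at hxy ⊢
      exact (hρ 0).injective.ne hxy
    | succ n ih =>
      rw [SG_succ] at hxy ⊢
      obtain ⟨i, u, v, huv, rfl, rfl⟩ := (isGluing_copy n).glue_adj.1 hxy
      rw [hcopy, hcopy, (isGluing_copy n).adj_copy_iff]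
      exact ih u v huv
  ext x y
  refine ⟨fun hxy => ?_, adj_apply x y⟩
  simpa only [hρ n _] using adj_apply _ _ hxy

theorem tilde_involutive (n : ℕ) : Involutive (tilde (n := n)) := fun _ => rfl

theorem hat_involutive (n : ℕ) : Involutive (hat (n := n)) := by
  intro x
  have := add_le_of_mem x.2
  rw [vert_ext_iff]
  simp only [hat, true_and]
  omega

theorem tilde_copy (n : ℕ) (i : Fin 3) (x : Vert n) :
    tilde (copy n i x) = copy n (Equiv.swap 1 2 i) (tilde x) := by
  rw [vert_ext_iff]
  fin_cases i <;> simp [tilde, copy, offset, Equiv.swap_apply_def]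

theorem hat_copy (n : ℕ) (i : Fin 3) (x : Vert n) :
    hat (copy n i x) = copy n (Equiv.swap 0 2 i) (hat x) := by
  have := add_le_of_mem x.2
  rw [vert_ext_iff]
  fin_cases i <;> simp [hat, copy, offset, pow_succ, Equiv.swap_apply_def] <;> omega

theorem tilde_corner (n : ℕ) (i : Fin 3) : tilde (corner n i) = corner n (Equiv.swap 1 2 i) := by
  fin_cases i <;> rfl

theorem hat_corner (n : ℕ) (i : Fin 3) : hat (corner n i) = corner n (Equiv.swap 0 2 i) := by
  rw [vert_ext_iff]
  fin_cases i <;> simp [hat, corner, o, rightmost, topmost, Equiv.swap_apply_def]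

theorem probRow_tilde (j n : ℕ) (x : Vert n) (r : Fin 5) :
    probRow j n (tilde x) r = probRow j n x (Equiv.swap 1 2 r) := by
  refine probRow_apply_of_comap (tilde_involutive n).toPerm
    (comap_SG_of_copy (fun _ => tilde) tilde_involutive tilde_copy n) (.swap 1 2)
    (tilde_corner n) (Setoid.ext fun k l => ?_) j x
  rw [Setoid.comap_rel, partition_rel, partition_rel]
  revert r k l
  decide

theorem probRow_hat (j n : ℕ) (x : Vert n) (r : Fin 5) :
    probRow j n (hat x) r = probRow j n x (Equiv.swap 1 3 r) := by
  refine probRow_apply_of_comap (hat_involutive n).toPerm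
    (comap_SG_of_copy (fun _ => hat) hat_involutive hat_copy n) (.swap 0 2)
    (hat_corner n) (Setoid.ext fun k l => ?_) j x
  rw [Setoid.comap_rel, partition_rel, partition_rel]
  revert r k l
  decide

theorem tilde_lacunary (k : ℕ) (i : Fin 3) :
    tilde (lacunary k i) = lacunary k (Equiv.swap 0 1 i) := by
  fin_cases i <;> rfl

theorem hat_lacunary (k : ℕ) (i : Fin 3) :
    hat (lacunary k i) = lacunary k (Equiv.swap 0 2 i) := by
  rw [vert_ext_iff]
  fin_cases i <;> simp [hat, lacunary, pow_succ, Equiv.swap_apply_def] <;> omega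

/-! ### The sum over all vertices -/

theorem F_eq_probRow (j n : ℕ) (x : Vert n) : F j n x = probRow j n x 0 := by
  rw [F, treeSet_eq, probRow]

theorem B_apply (j k : ℕ) (i : Fin 3) : B j k i = probRow j (k + 1) (lacunary k i) := by
  have hG (x : Vert (k + 1)) : G j (k + 1) x = probRow j (k + 1) x 1 := by
    rw [G, twoTreeSet_eq, probRow]
  have hH (x : Vert (k + 1)) : H j (k + 1) x = probRow j (k + 1) x 4 := by
    rw [H, threeTreeSet_eq, probRow]
  ext r
  simp only [B, of_apply, F_eq_probRow, hG, hH, probRow_tilde, probRow_hat]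
  fin_cases r <;> rfl

theorem ones_vecMul_B (j k : ℕ) :
    ![1, 1, 1] ᵥ* B j k = ∑ i, probRow j (k + 1) (lacunary k i) := by
  ext r
  simp [vecMul, dotProduct, Fin.sum_univ_three, B_apply]

/-- The sum of the degree probabilities over the vertices of `SG(n)` other than the corners. -/
noncomputable def interiorSum (j n : ℕ) : Fin 5 → ℚ :=
  ∑ x : {x : Vert n // x ∉ Set.range (corner n)}, probRow j n x

theorem sum_eq_interiorSum_add (j n : ℕ) :
    ∑ x, probRow j n x = interiorSum j n + ∑ k, probRow j n (corner n k) := by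
  rw [← Fintype.sum_subtype_add_sum_subtype (· ∈ Set.range (corner n)), add_comm, interiorSum]
  congr 1
  convert ((Equiv.ofInjective _ (corner_injective n)).sum_comp fun x => probRow j n x).symm
  rfl

theorem interiorSum_zero (j : ℕ) : interiorSum j 0 = 0 :=
  have : IsEmpty {x : Vert 0 // x ∉ Set.range (corner 0)} :=
    ⟨fun x => x.2 (corner_zero_surjective x)⟩
  Fintype.sum_empty _

theorem sum_junction (n : ℕ) {M : Type*} [AddCommMonoid M] (f : Vert (n + 1) → M) :
    ∑ z, f ((isGluing_copy n).junction z) =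
      ∑ k, f (corner (n + 1) k) + ∑ i, f (lacunary n i) := by
  have huniv : (Finset.univ : Finset (Sym2 (Fin 3))) =
    {s(0, 0), s(1, 1), s(2, 2), s(0, 1), s(0, 2), s(1, 2)} := by decide
  rw [huniv, corner_succ, lacunary_eq]
  simp [Fin.sum_univ_three, IsGluing.junction, add_assoc]

theorem interiorSum_succ (j n : ℕ) : interiorSum j (n + 1) =
    interiorSum j n ᵥ* ∑ i, transfer i + ![1, 1, 1] ᵥ* B j n := by
  have hcopies : ∑ i, ∑ u : {u // u ∉ Set.range (corner n)}, probRow j (n + 1) (copy n i u) =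
      interiorSum j n ᵥ* ∑ i, transfer i := by
    rw [Matrix.vecMul_sum]
    refine Finset.sum_congr rfl fun i _ => ?_
    rw [interiorSum, Matrix.sum_vecMul]
    exact Finset.sum_congr rfl fun u _ => probRow_copy j n i u.2
  have hsum := (isGluing_copy n).sum_eq_sum_interior_add_sum_junction (probRow j (n + 1))
  rw [sum_eq_interiorSum_add, sum_junction, hcopies, ← ones_vecMul_B, add_comm (∑ k, _),
    ← add_assoc] at hsum
  exact add_right_cancel hsum

theorem interiorSum_eq (j n : ℕ) : interiorSum j n =
    ![1, 1, 1] ᵥ* ∑ m ∈ Finset.Icc 1 n, B j (m - 1) * (∑ i, transfer i) ^ (n - m) := by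
  induction n with
  | zero => simp [interiorSum_zero]
  | succ n ih =>
    have hpow : ∀ m ∈ Finset.Icc 1 n, B j (m - 1) * (∑ i, transfer i) ^ (n + 1 - m) =
        B j (m - 1) * (∑ i, transfer i) ^ (n - m) * ∑ i, transfer i := fun m hm => by
      rw [Matrix.mul_assoc, ← pow_succ, Nat.succ_sub (Finset.mem_Icc.1 hm).2]
    rw [interiorSum_succ, ih, vecMul_vecMul, Finset.sum_Icc_succ_top (by omega),
      Finset.sum_congr rfl hpow, ← Matrix.sum_mul, Nat.sub_self, pow_zero, Matrix.mul_one,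
      Nat.add_sub_cancel, vecMul_add]

theorem F_corner (j n : ℕ) (k : Fin 3) : F j n (corner n k) = F j n (o n) := by
  have htilde : F j n (topmost n) = F j n (rightmost n) := by
    rw [F_eq_probRow, F_eq_probRow]
    exact probRow_tilde j n (rightmost n) 0
  have hhat : F j n (topmost n) = F j n (o n) := by
    rw [F_eq_probRow, F_eq_probRow]
    exact (congrArg (probRow j n · 0) (hat_corner n 0).symm).trans (probRow_hat j n (o n) 0)
  fin_cases k
  exacts [rfl, htilde.symm.trans hhat, hhat]

theorem Phi_eq (j n : ℕ) : Phi j n = sandwich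
    (∑ m ∈ Finset.Icc 1 n, B j (m - 1) * (∑ i, transfer i) ^ (n - m)) + 3 * F j n (o n) := by
  have hsum := congrFun (sum_eq_interiorSum_add j n) 0
  simp only [Finset.sum_apply, Pi.add_apply, ← F_eq_probRow, F_corner] at hsum
  rw [Phi, hsum, interiorSum_eq, sandwich, dotProduct_mulVec]
  simp [e1, dotProduct, Fin.sum_univ_five]

/-! ### Powers of the transfer matrix -/

/-- The row vectors that are fixed by the symmetries of the triangle; these permute the indices
`1`, `2`, `3` of the three partitions that separate one corner from the other two. -/
def IsSymmetric (v : Fin 5 → ℚ) : Prop := v 1 = v 2 ∧ v 2 = v 3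

theorem IsSymmetric.vecMul_swap {v : Fin 5 → ℚ} (hv : IsSymmetric v) {a b : Fin 5}
    (ha : a ∈ ({1, 2, 3} : Finset (Fin 5))) (hb : b ∈ ({1, 2, 3} : Finset (Fin 5))) :
    v ᵥ* swap ℚ a b = v := by
  have happly : ∀ c ∈ ({1, 2, 3} : Finset (Fin 5)), v c = v 2 := by
    simp [hv.1, hv.2]
  rw [Matrix.vecMul_swap]
  ext c
  rw [Function.comp_apply, Equiv.swap_apply_def]
  split_ifs with hca hcb
  · rw [hca, happly a ha, happly b hb]
  · rw [hcb, happly a ha, happly b hb]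
  · rfl

theorem swap_mulVec_e1 {a b : Fin 5} (ha : a ≠ 0) (hb : b ≠ 0) : swap ℚ a b *ᵥ e1 = e1 := by
  revert a b
  decide +kernel

theorem matE_eq : matE = swap ℚ 2 3 + 1 + swap ℚ 1 2 := by
  decide +kernel

theorem IsSymmetric.vecMul_sum_transfer {v : Fin 5 → ℚ} (hv : IsSymmetric v) :
    v ᵥ* ∑ i, transfer i = v ᵥ* (matR * matE) := by
  rw [Fin.sum_univ_three, transfer_zero, transfer_one, transfer_two, matE_eq, Matrix.mul_add,
    Matrix.mul_add, Matrix.mul_one]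
  simp only [vecMul_add, ← vecMul_vecMul, hv.vecMul_swap, Finset.mem_insert, Finset.mem_singleton,
    true_or, or_true]

theorem IsSymmetric.vecMul_matR_mul_matE {v : Fin 5 → ℚ} (hv : IsSymmetric v) :
    IsSymmetric (v ᵥ* (matR * matE)) := by
  obtain ⟨h12, h23⟩ := hv
  rw [← vecMul_vecMul]
  constructor <;> simp [matR, matE, vecMul, dotProduct, Fin.sum_univ_five, h12, h23] <;> ring

theorem swap_one_three_mul_matR : swap ℚ 1 3 * matR = matR * swap ℚ 1 3 := by
  decide +kernel

theorem transfer_two_eq_conj : transfer 2 = swap ℚ 1 3 * transfer 0 * swap ℚ 1 3 := by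
  rw [transfer_two, transfer_zero]
  decide +kernel

theorem matL_pow_mulVec_e1_apply (k : ℕ) :
    (matL ^ k *ᵥ e1) 3 = 0 ∧ (matL ^ k *ᵥ e1) 4 = 0 := by
  have hstep (w : Fin 5 → ℚ) (hw : w 3 = 0 ∧ w 4 = 0) :
      (matL *ᵥ w) 3 = 0 ∧ (matL *ᵥ w) 4 = 0 := by
    simp [mulVec, dotProduct, Fin.sum_univ_five, matL, hw]
  induction k with
  | zero => simp [e1]
  | succ k ih =>
    rw [pow_succ', ← mulVec_mulVec]
    exact hstep _ ih

theorem updateCol_mulVec_of_apply_eq_zero {m n R : Type*} [Fintype n] [DecidableEq n]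
    [NonUnitalNonAssocSemiring R] (M : Matrix m n R) {c : n} (u : m → R) {w : n → R}
    (hw : w c = 0) : M.updateCol c u *ᵥ w = M *ᵥ w := by
  ext i
  simp only [mulVec, dotProduct]
  refine Finset.sum_congr rfl fun d _ => ?_
  obtain rfl | hd := eq_or_ne d c
  · rw [hw, mul_zero, mul_zero]
  · rw [updateCol_ne hd]

theorem transfer_zero_eq_updateCol :
    transfer 0 = matL.updateCol 3 ![1/10, 1/10, 1/10, 2/5, 3/10] := by
  rw [transfer_zero]
  decide +kernel

theorem transfer_zero_pow_mulVec_e1 (k : ℕ) : transfer 0 ^ k *ᵥ e1 = matL ^ k *ᵥ e1 := by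
  induction k with
  | zero => rfl
  | succ k ih =>
    rw [pow_succ', ← mulVec_mulVec, ih, pow_succ' matL, ← mulVec_mulVec,
      transfer_zero_eq_updateCol,
      updateCol_mulVec_of_apply_eq_zero _ _ (matL_pow_mulVec_e1_apply k).1]

theorem swap_mul_matR_pow_mulVec_e1 (k : ℕ) :
    swap ℚ 2 3 *ᵥ matR ^ k *ᵥ e1 = matL ^ k *ᵥ e1 := by
  have hsemiconj : SemiconjBy (swap ℚ (2 : Fin 5) 3) matR (transfer 0) := by
    rw [SemiconjBy, transfer_zero, Matrix.mul_assoc, swap_mul_self, Matrix.mul_one]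
  rw [mulVec_mulVec, (hsemiconj.pow_right k).eq, ← mulVec_mulVec,
    swap_mulVec_e1 (by decide) (by decide), transfer_zero_pow_mulVec_e1]

theorem IsSymmetric.dotProduct_transfer_zero_mulVec {v : Fin 5 → ℚ} (hv : IsSymmetric v) (k : ℕ) :
    v ⬝ᵥ transfer 0 *ᵥ matR ^ k *ᵥ e1 = v ⬝ᵥ matR *ᵥ matL ^ k *ᵥ e1 := by
  rw [transfer_zero, ← mulVec_mulVec, ← mulVec_mulVec, swap_mul_matR_pow_mulVec_e1,
    dotProduct_mulVec, hv.vecMul_swap (by decide) (by decide)]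

theorem IsSymmetric.dotProduct_transfer_two_mulVec {v : Fin 5 → ℚ} (hv : IsSymmetric v) (k : ℕ) :
    v ⬝ᵥ transfer 2 *ᵥ matR ^ k *ᵥ e1 = v ⬝ᵥ matR *ᵥ matL ^ k *ᵥ e1 := by
  have hcommute : Commute (swap ℚ (1 : Fin 5) 3) matR := swap_one_three_mul_matR
  have hfixed : swap ℚ 1 3 *ᵥ matR ^ k *ᵥ e1 = matR ^ k *ᵥ e1 := by
    rw [mulVec_mulVec, (hcommute.pow_right k).eq, ← mulVec_mulVec,
      swap_mulVec_e1 (by decide) (by decide)]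
  rw [transfer_two_eq_conj, ← mulVec_mulVec, ← mulVec_mulVec, hfixed, dotProduct_mulVec,
    hv.vecMul_swap (by decide) (by decide), hv.dotProduct_transfer_zero_mulVec]

/-- The sum `∑_{s < k} R (E R) ^ s L ^ (k - 1 - s)`. -/
def runSum (k : ℕ) : Matrix (Fin 5) (Fin 5) ℚ :=
  ∑ s ∈ Finset.range k, matR * (matE * matR) ^ s * matL ^ (k - 1 - s)

theorem runSum_zero : runSum 0 = 0 := rfl

theorem runSum_succ (k : ℕ) :
    runSum (k + 1) = matR * matL ^ k + matR * matE * runSum k := by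
  rw [runSum, Finset.sum_range_succ', runSum, Finset.mul_sum, add_comm]
  congr 1
  · simp
  · refine Finset.sum_congr rfl fun s _ => ?_
    rw [pow_succ', show k + 1 - 1 - (s + 1) = k - 1 - s by omega]
    simp only [mul_assoc]

theorem IsSymmetric.dotProduct_sum_transfer_pow {v : Fin 5 → ℚ} (hv : IsSymmetric v) (k : ℕ) :
    v ⬝ᵥ (∑ i, transfer i) ^ k *ᵥ e1 = v ⬝ᵥ (matR ^ k + 2 • runSum k) *ᵥ e1 := by
  induction k generalizing v with
  | zero => simp [runSum]
  | succ k ih =>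
    have hsplit : v ⬝ᵥ (∑ i, transfer i) *ᵥ matR ^ k *ᵥ e1 =
        v ⬝ᵥ matR ^ (k + 1) *ᵥ e1 + 2 * (v ⬝ᵥ (matR * matL ^ k) *ᵥ e1) := by
      rw [Fin.sum_univ_three, add_mulVec, add_mulVec, dotProduct_add, dotProduct_add,
        hv.dotProduct_transfer_zero_mulVec, hv.dotProduct_transfer_two_mulVec, transfer_one,
        pow_succ', mulVec_mulVec, mulVec_mulVec]
      ring
    rw [pow_succ', ← mulVec_mulVec, dotProduct_mulVec, hv.vecMul_sum_transfer,
      ih hv.vecMul_matR_mul_matE, runSum_succ, add_mulVec, dotProduct_add,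
      ← hv.vecMul_sum_transfer, ← dotProduct_mulVec, hsplit, hv.vecMul_sum_transfer]
    simp only [two_nsmul, add_mulVec, dotProduct_add, ← dotProduct_mulVec,
      mulVec_mulVec]
    ring

theorem isSymmetric_ones_vecMul_B (j k : ℕ) : IsSymmetric (![1, 1, 1] ᵥ* B j k) := by
  have hsum (π : Equiv.Perm (Fin 3)) (ρ : Vert (k + 1) → Vert (k + 1))
      (hρ : ∀ i, ρ (lacunary k i) = lacunary k (π i)) (r : Fin 5) :
      ∑ i, probRow j (k + 1) (ρ (lacunary k i)) r = ∑ i, probRow j (k + 1) (lacunary k i) r := by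
    simp only [hρ]
    exact Equiv.sum_comp π fun i => probRow j (k + 1) (lacunary k i) r
  have htilde := hsum _ tilde (tilde_lacunary k) 1
  have hhat := hsum _ hat (hat_lacunary k) 1
  simp only [probRow_tilde, probRow_hat, Equiv.swap_apply_left] at htilde hhat
  simp only [IsSymmetric, ones_vecMul_B, Finset.sum_apply]
  exact ⟨htilde.symm, htilde.trans hhat.symm⟩

theorem Phi_eq_sandwich_runSum (j n : ℕ) : Phi j n =
    sandwich (∑ m ∈ Finset.Icc 1 n, B j (m - 1) * matR ^ (n - m)
      + 2 • ∑ m ∈ Finset.Icc 1 n, B j (m - 1) * runSum (n - m)) + 3 * F j n (o n) := by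
  have hterm (m k : ℕ) : ![1, 1, 1] ⬝ᵥ (B j m * (∑ i, transfer i) ^ k) *ᵥ e1 =
      ![1, 1, 1] ⬝ᵥ (B j m * (matR ^ k + 2 • runSum k)) *ᵥ e1 := by
    rw [← mulVec_mulVec, dotProduct_mulVec,
      (isSymmetric_ones_vecMul_B j m).dotProduct_sum_transfer_pow, ← dotProduct_mulVec,
      mulVec_mulVec]
  have hsum : (∑ m ∈ Finset.Icc 1 n, B j (m - 1) * matR ^ (n - m)) +
      2 • ∑ m ∈ Finset.Icc 1 n, B j (m - 1) * runSum (n - m) =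
      ∑ m ∈ Finset.Icc 1 n, B j (m - 1) * (matR ^ (n - m) + 2 • runSum (n - m)) := by
    simp only [Matrix.mul_add, Matrix.mul_smul, Finset.sum_add_distrib, Finset.smul_sum]
  rw [Phi_eq, hsum]
  simp only [sandwich, sum_mulVec, dotProduct_sum, hterm]

theorem runSum_succ_eq_sum_Icc (k : ℕ) : runSum (k + 1) =
    ∑ s ∈ Finset.Icc 0 k, matR * (matE * matR) ^ s * matL ^ (k - s) := by
  rw [runSum, Nat.range_succ_eq_Icc_zero, Nat.add_sub_cancel]

theorem runSum_succ_eq_add_sum_Icc (k : ℕ) : runSum (k + 1) = matR * matL ^ k +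
    ∑ s ∈ Finset.Icc 1 k, matR * (matE * matR) ^ s * matL ^ (k - s) := by
  rw [runSum_succ_eq_sum_Icc, ← Finset.insert_Icc_add_one_left_eq_Icc k.zero_le,
    Finset.sum_insert (by simp), pow_zero, mul_one, Nat.sub_zero, zero_add]

theorem sum_mul_runSum_eq_add_sum_Icc_zero {ι : Type*} (M : ℕ → Matrix ι (Fin 5) ℚ) {n : ℕ}
    (hn : 2 ≤ n) : ∑ m ∈ Finset.Icc 1 n, M m * runSum (n - m) =
      M (n - 1) * matR + ∑ m ∈ Finset.Icc 1 (n - 2), M m *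
        ∑ s ∈ Finset.Icc 0 (n - m - 1), matR * (matE * matR) ^ s * matL ^ (n - m - 1 - s) := by
  have hterm : ∀ m ∈ Finset.Icc 1 (n - 2), M m * runSum (n - m) = M m *
      ∑ s ∈ Finset.Icc 0 (n - m - 1), matR * (matE * matR) ^ s * matL ^ (n - m - 1 - s) := by
    intro m hm
    rw [← runSum_succ_eq_sum_Icc]
    congr 2
    have := Finset.mem_Icc.1 hm
    omega
  rw [← Finset.sum_congr rfl hterm]
  obtain ⟨k, rfl⟩ := Nat.exists_eq_add_of_le' hn
  rw [add_comm (_ * matR)]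
  simp [Finset.sum_Icc_succ_top, runSum_succ, runSum_zero]

theorem sum_mul_runSum_eq_add_sum_Icc_one {ι : Type*} (M : ℕ → Matrix ι (Fin 5) ℚ) {n : ℕ}
    (hn : 2 ≤ n) : ∑ m ∈ Finset.Icc 1 n, M m * runSum (n - m) =
      ∑ m ∈ Finset.Icc 1 (n - 1), M m * matR * matL ^ (n - m - 1) +
      ∑ m ∈ Finset.Icc 1 (n - 2), M m *
        ∑ s ∈ Finset.Icc 1 (n - m - 1), matR * (matE * matR) ^ s * matL ^ (n - 1 - m - s) := by
  have htop : ∑ m ∈ Finset.Icc 1 (n - 1), M m * matR * matL ^ (n - m - 1) =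
      M (n - 1) * matR + ∑ m ∈ Finset.Icc 1 (n - 2), M m * matR * matL ^ (n - m - 1) := by
    obtain ⟨k, rfl⟩ := Nat.exists_eq_add_of_le' hn
    simp [Finset.sum_Icc_succ_top, add_comm]
  rw [sum_mul_runSum_eq_add_sum_Icc_zero M hn, htop, add_assoc, ← Finset.sum_add_distrib]
  congr 1
  refine Finset.sum_congr rfl fun m _ => ?_
  rw [← runSum_succ_eq_sum_Icc, runSum_succ_eq_add_sum_Icc, Matrix.mul_add, Matrix.mul_assoc,
    Nat.sub_right_comm n m 1]

end SierpinskiGasket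

/-- In the sums below `B j (m - 1)` is the matrix `B_j(m, m - 1)`, where `m ≥ 1`. -/
theorem mainTheorem5 (n : ℕ) (hn : 3 ≤ n) (j : ℕ) (hj1 : 1 ≤ j) (hj4 : j ≤ 4) :
    Phi j n =
        sandwich (∑ m ∈ Finset.Icc 1 n, B j (m - 1) * matR ^ (n - m)
          + 2 • ∑ m ∈ Finset.Icc 1 (n - 1), B j (m - 1) * matR * matL ^ (n - m - 1)
          + 2 • ∑ m ∈ Finset.Icc 1 (n - 2), B j (m - 1) *
              ∑ s ∈ Finset.Icc 1 (n - m - 1), matR * (matE * matR) ^ s * matL ^ (n - 1 - m - s))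
        + 3 * F j n (o n) ∧
    Phi j n =
        sandwich (∑ m ∈ Finset.Icc 1 n, B j (m - 1) * matR ^ (n - m)
          + 2 • (B j (n - 2) * matR)
          + 2 • ∑ m ∈ Finset.Icc 1 (n - 2), B j (m - 1) *
              ∑ s ∈ Finset.Icc 0 (n - m - 1), matR * (matE * matR) ^ s * matL ^ (n - m - 1 - s))
        + 3 * F j n (o n) := by
  have hn2 : 2 ≤ n := Nat.le_of_succ_le hn
  constructor
  · rw [Phi_eq_sandwich_runSum, sum_mul_runSum_eq_add_sum_Icc_one (fun m => B j (m - 1)) hn2,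
      smul_add, ← add_assoc]
  · rw [Phi_eq_sandwich_runSum, sum_mul_runSum_eq_add_sum_Icc_zero (fun m => B j (m - 1)) hn2,
      smul_add, ← add_assoc, Nat.sub_sub]
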